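/- Let $M$ be a smooth $4$-dimensional manifold, let $a$ be a smooth pseudo-Riemannian metric and $b$ a smooth $1$-form on $M$. A Finsler spacetime is a triple $(M,\mathcal A,F)$ where $\mathcal A\subset TM$ is open and conic ($(x,y)\in\mathcal A$, $\lambda>0$ imply $(x,\lambda y)\in\mathcal A$) with nonempty fibres over every point of $M$, and $F:\mathcal A\to[0,\infty)$ is smooth, satisfies $F(x,\lambda y)=\lambda F(x,y)$ for $\lambda>0$, and has fundamental tensor $g_{ij}=\frac12\frac{\partial^2F^2}{\partial y^i\partial y^j}$ of Lorentzian signature (in either sign convention) at every point of $\mathcal A$. It is of Randers type, $F=\alpha+\beta$, if on $\mathcal A$ one has $a_{ij}(x)y^iy^j>0$ and $F(x,y)=\alpha(x,y)+\beta(x,y)$ with $\alpha=\sqrt{a_{ij}(x)y^iy^j}$ and $\beta=b_i(x)y^i$. In local coordinates $(x,y)$ induced by charts of $M$, put on $\mathcal A$ $$N^i_j=\tfrac14\,\frac{\partial}{\partial y^j}\Big(g^{ik}\Big(y^l\frac{\partial^2F^2}{\partial x^l\partial y^k}-\frac{\partial F^2}{\partial x^k}\Big)\Big),\qquad \delta_j=\frac{\partial}{\partial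 x^j}-N^m_j\frac{\partial}{\partial y^m},$$ $$R^i{}_{jk}=\delta_jN^i_k-\delta_kN^i_j,\qquad \mathrm{Ric}=R^i{}_{ij}\,y^j,\qquad R_{ij}=\tfrac12\,\frac{\partial^2\mathrm{Ric}}{\partial y^i\partial y^j}.$$ $F$ is Berwald if in every chart $N^i_j(x,y)=\Gamma^i_{jk}(x)\,y^k$ on $\mathcal A$ for some functions $\Gamma^i_{jk}$ of $x$ alone. A Berwald $F$ is a solution of the vacuum Finsler field equation if $$\Big(g^{ij}-\frac{3}{F^2}\,y^iy^j\Big)R_{ij}=0\qquad\text{on }\mathcal A .$$ $\alpha$ solves the vacuum Einstein equations if the Ricci tensor of the Levi-Civita connection of $a$ vanishes, and $\beta$ is parallel with respect to $\alpha$ if $\nabla_ib_j=0$ for that connection. Let $(M,\mathcal A,F)$ be a Finsler spacetime of Randers type, $F=\alpha+\beta$. Then the following are equivalent: 1. $F$ is Berwald and solves the vacuum Finsler field equation; 2. $\alpha$ solves the vacuum Einstein equations and $F$ is Berwald; 3. $\alpha$ solves the vacuum Einstein equations and $\beta$ is parallel with respect to $\alpha$. -/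

import Mathlib

open scoped Manifold ContDiff Matrix

noncomputable section

namespace RandersSpacetime

/-! ### Calculus in local coordinates

`x` denotes a point of an open subset of `ℝ⁴` (a chart domain), `y` the induced fibre coordinates
of a tangent vector. Functions of `(x, y)` are written in curried form. -/

/-- Coordinate space `ℝ⁴`. -/
abbrev Coord : Type := EuclideanSpace ℝ (Fin 4)

/-- The partial derivative `∂ᵢ f = ∂f/∂xⁱ` of a function of `x`. -/
def pd (i : Fin 4) (f : Coord → ℝ) : Coord → ℝ := fun x =>
  fderiv ℝ f x (EuclideanSpace.single i 1)

/-- The partial derivative `∂f/∂xⁱ` of a function of `(x, y)`. -/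
def dx (i : Fin 4) (f : Coord → Coord → ℝ) : Coord → Coord → ℝ := fun x y =>
  fderiv ℝ (fun x' => f x' y) x (EuclideanSpace.single i 1)

/-- The partial derivative `∂f/∂yⁱ` of a function of `(x, y)`. -/
def dy (i : Fin 4) (f : Coord → Coord → ℝ) : Coord → Coord → ℝ := fun x y =>
  fderiv ℝ (f x) y (EuclideanSpace.single i 1)

/-! ### Finsler geometry in local coordinates

In this section `F : Coord → Coord → ℝ` is the coordinate expression `F(x, y)` of a Finsler
function. -/

/-- The function `F²`. -/
def sqFun (F : Coord → Coord → ℝ) : Coord → Coord → ℝ := fun x y => F x y ^ 2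

/-- The fundamental tensor `g_{ij} = ∂²(F²/2) / ∂yⁱ∂yʲ`. -/
def fundamentalTensor (F : Coord → Coord → ℝ) (x y : Coord) : Matrix (Fin 4) (Fin 4) ℝ :=
  Matrix.of fun i j => dy i (dy j (fun x y => (1 / 2 : ℝ) * F x y ^ 2)) x y

/-- The Cartan nonlinear connection
`Nⁱⱼ = (1/4) ∂/∂yʲ ( g^{ik} ( yˡ ∂²F²/∂xˡ∂yᵏ - ∂F²/∂xᵏ ) )`. -/
def cartanConnection (F : Coord → Coord → ℝ) (i j : Fin 4) : Coord → Coord → ℝ := fun x y =>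
  (1 / 4 : ℝ) * dy j (fun x y => ∑ k, (fundamentalTensor F x y)⁻¹ i k *
    ((∑ l, y l * dx l (dy k (sqFun F)) x y) - dx k (sqFun F) x y)) x y

/-- The horizontal derivative `δⱼ f = ∂f/∂xʲ - Nᵐⱼ ∂f/∂yᵐ`. -/
def horizontalDeriv (F : Coord → Coord → ℝ) (j : Fin 4) (f : Coord → Coord → ℝ) :
    Coord → Coord → ℝ := fun x y =>
  dx j f x y - ∑ m, cartanConnection F m j x y * dy m f x y

/-- The curvature `Rⁱⱼₖ = δⱼ Nⁱₖ - δₖ Nⁱⱼ` of the Cartan nonlinear connection. -/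
def finslerCurvature (F : Coord → Coord → ℝ) (i j k : Fin 4) : Coord → Coord → ℝ := fun x y =>
  horizontalDeriv F j (cartanConnection F i k) x y -
    horizontalDeriv F k (cartanConnection F i j) x y

/-- The Finsler Ricci scalar `Ric = Rⁱᵢⱼ yʲ`. -/
def finslerRic (F : Coord → Coord → ℝ) : Coord → Coord → ℝ := fun x y =>
  ∑ i, ∑ j, finslerCurvature F i i j x y * y j

/-- The Finsler Ricci tensor `R_{ij} = (1/2) ∂²Ric / ∂yⁱ∂yʲ`. -/
def finslerRicciTensor (F : Coord → Coord → ℝ) (i j : Fin 4) : Coord → Coord → ℝ := fun x y =>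
  (1 / 2 : ℝ) * dy i (dy j (finslerRic F)) x y

/-- Lorentzian signature, in either of the two sign conventions `(+,-,-,-)` and `(-,+,+,+)`. -/
def IsLorentzian (g : Matrix (Fin 4) (Fin 4) ℝ) : Prop :=
  ∃ P : Matrix (Fin 4) (Fin 4) ℝ, IsUnit P.det ∧
    (Pᵀ * g * P = Matrix.diagonal ![1, -1, -1, -1] ∨
      Pᵀ * g * P = Matrix.diagonal ![-1, 1, 1, 1])

/-! ### Pseudo-Riemannian geometry in local coordinates

In this section `a : Coord → Matrix (Fin 4) (Fin 4) ℝ` is the component matrix of a metric. -/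

/-- The Christoffel symbols `Γⁱⱼₖ = (1/2) a^{il} (∂ⱼ a_{lk} + ∂ₖ a_{lj} - ∂ₗ a_{jk})` of the
Levi-Civita connection. -/
def christoffel (a : Coord → Matrix (Fin 4) (Fin 4) ℝ) (i j k : Fin 4) : Coord → ℝ := fun x =>
  (1 / 2 : ℝ) * ∑ l, (a x)⁻¹ i l *
    (pd j (fun x => a x l k) x + pd k (fun x => a x l j) x - pd l (fun x => a x j k) x)

/-- The Riemann tensor
`R̄ₗⁱⱼₖ = ∂ⱼ Γⁱₖₗ - ∂ₖ Γⁱⱼₗ + Γⁱₘⱼ Γᵐₖₗ - Γⁱₘₖ Γᵐⱼₗ` of the Levi-Civita connection. -/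
def riemann (a : Coord → Matrix (Fin 4) (Fin 4) ℝ) (l i j k : Fin 4) : Coord → ℝ := fun x =>
  pd j (christoffel a i k l) x - pd k (christoffel a i j l) x +
    ∑ m, (christoffel a i m j x * christoffel a m k l x -
      christoffel a i m k x * christoffel a m j l x)

/-- The Ricci tensor `R̄ₗₖ = R̄ₗⁱᵢₖ`. -/
def ricci (a : Coord → Matrix (Fin 4) (Fin 4) ℝ) (l k : Fin 4) : Coord → ℝ := fun x =>
  ∑ i, riemann a l i i k x

/-! ### Global objects on a 4-manifold

A chart is an element of the maximal smooth atlas. -/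

variable {M : Type*} [TopologicalSpace M] [ChartedSpace Coord M]

/-- The tangent vector with coordinates `(x, y)` in the chart `e`, that is, the vector
`yⁱ ∂/∂xⁱ` at the point of `M` with coordinates `x`. -/
def ofCoord (e : OpenPartialHomeomorph M Coord) (x y : Coord) : TangentBundle (𝓡 4) M :=
  ⟨e.symm x, mfderiv (𝓡 4) (𝓡 4) e.symm x y⟩

/-- The coordinate expression in the chart `e` of a function on the tangent bundle. -/
def inChart (e : OpenPartialHomeomorph M Coord) (F : TangentBundle (𝓡 4) M → ℝ) :
    Coord → Coord → ℝ := fun x y => F (ofCoord e x y)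

variable (M) in
/-- A smooth pseudo-Riemannian metric on `M`: a nondegenerate symmetric bilinear form of arbitrary
signature on every tangent space, with smooth components in every chart. -/
structure PseudoRiemannianMetric where
  /-- The bilinear form on the tangent space at a point. -/
  form : ∀ p : M, TangentSpace (𝓡 4) p →L[ℝ] TangentSpace (𝓡 4) p →L[ℝ] ℝ
  symm : ∀ (p : M) (v w : TangentSpace (𝓡 4) p), form p v w = form p w v
  nondegenerate : ∀ (p : M) (v : TangentSpace (𝓡 4) p), (∀ w, form p v w = 0) → v = 0
  smooth : ∀ e ∈ IsManifold.maximalAtlas (𝓡 4) ∞ M, ∀ i j : Fin 4,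
    ContDiffOn ℝ ∞ (fun x => form (e.symm x)
      (mfderiv (𝓡 4) (𝓡 4) e.symm x (EuclideanSpace.single i (1 : ℝ)))
      (mfderiv (𝓡 4) (𝓡 4) e.symm x (EuclideanSpace.single j (1 : ℝ)))) e.target

/-- The component matrix `a_{ij}` of a metric in the chart `e`. -/
def PseudoRiemannianMetric.components (a : PseudoRiemannianMetric M)
    (e : OpenPartialHomeomorph M Coord) (x : Coord) : Matrix (Fin 4) (Fin 4) ℝ :=
  Matrix.of fun i j => a.form (e.symm x)
    (mfderiv (𝓡 4) (𝓡 4) e.symm x (EuclideanSpace.single i (1 : ℝ)))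
    (mfderiv (𝓡 4) (𝓡 4) e.symm x (EuclideanSpace.single j (1 : ℝ)))

variable (M) in
/-- A smooth 1-form on `M`. -/
structure OneForm where
  /-- The linear form on the tangent space at a point. -/
  form : ∀ p : M, TangentSpace (𝓡 4) p →L[ℝ] ℝ
  smooth : ∀ e ∈ IsManifold.maximalAtlas (𝓡 4) ∞ M, ∀ i : Fin 4,
    ContDiffOn ℝ ∞ (fun x => form (e.symm x)
      (mfderiv (𝓡 4) (𝓡 4) e.symm x (EuclideanSpace.single i (1 : ℝ)))) e.target

/-- The components `bᵢ` of a 1-form in the chart `e`. -/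
def OneForm.components (b : OneForm M) (e : OpenPartialHomeomorph M Coord) (i : Fin 4)
    (x : Coord) : ℝ :=
  b.form (e.symm x) (mfderiv (𝓡 4) (𝓡 4) e.symm x (EuclideanSpace.single i (1 : ℝ)))

/-- `(M, A, F)` is a Finsler spacetime: `A` is an open conic subset of `TM` with nonempty fibres,
and `F : A → [0, ∞)` is smooth, positively homogeneous of degree one, with fundamental tensor of
Lorentzian signature on `A`. Only the values of `F` on `A` matter. -/
structure IsFinslerSpacetime [IsManifold (𝓡 4) ∞ M]
    (A : Set (TangentBundle (𝓡 4) M)) (F : TangentBundle (𝓡 4) M → ℝ) : Prop where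
  isOpen : IsOpen A
  conic : ∀ (p : M) (v : TangentSpace (𝓡 4) p) (c : ℝ), 0 < c →
    (⟨p, v⟩ : TangentBundle (𝓡 4) M) ∈ A → (⟨p, c • v⟩ : TangentBundle (𝓡 4) M) ∈ A
  fiber_nonempty : ∀ p : M, ∃ v : TangentSpace (𝓡 4) p, (⟨p, v⟩ : TangentBundle (𝓡 4) M) ∈ A
  smooth : ContMDiffOn (𝓡 4).tangent 𝓘(ℝ, ℝ) ∞ F A
  nonneg : ∀ v ∈ A, 0 ≤ F v
  homogeneous : ∀ (p : M) (v : TangentSpace (𝓡 4) p) (c : ℝ), 0 < c →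
    (⟨p, v⟩ : TangentBundle (𝓡 4) M) ∈ A → F ⟨p, c • v⟩ = c * F ⟨p, v⟩
  lorentzian : ∀ e ∈ IsManifold.maximalAtlas (𝓡 4) ∞ M, ∀ x ∈ e.target, ∀ y : Coord,
    ofCoord e x y ∈ A → IsLorentzian (fundamentalTensor (inChart e F) x y)

/-- `F = α + β` on `A`, where `α = √(a(y, y))` (with `a(y, y) > 0` on `A`, so that `α` is real and
smooth there) and `β = b(y)`. -/
def IsRanders (A : Set (TangentBundle (𝓡 4) M)) (F : TangentBundle (𝓡 4) M → ℝ)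
    (a : PseudoRiemannianMetric M) (b : OneForm M) : Prop :=
  ∀ (p : M) (v : TangentSpace (𝓡 4) p), (⟨p, v⟩ : TangentBundle (𝓡 4) M) ∈ A →
    0 < a.form p v v ∧ F ⟨p, v⟩ = √(a.form p v v) + b.form p v

/-- `F` is of Berwald type: in every chart the Cartan nonlinear connection is linear on `A`,
`Nⁱⱼ(x, y) = Γⁱⱼₖ(x) yᵏ`. -/
def IsBerwald (A : Set (TangentBundle (𝓡 4) M)) (F : TangentBundle (𝓡 4) M → ℝ) : Prop :=
  ∀ e ∈ IsManifold.maximalAtlas (𝓡 4) ∞ M, ∃ Γ : Fin 4 → Fin 4 → Fin 4 → Coord → ℝ,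
    ∀ x ∈ e.target, ∀ y : Coord, ofCoord e x y ∈ A →
      ∀ i j, cartanConnection (inChart e F) i j x y = ∑ k, Γ i j k x * y k

/-- The vacuum field equation of Finsler gravity for Berwald spacetimes:
`(g^{ij} - (3 / F²) yⁱ yʲ) R_{ij} = 0` on `A`, with `R_{ij}` the Finsler Ricci tensor. -/
def SolvesFinslerVacuum (A : Set (TangentBundle (𝓡 4) M)) (F : TangentBundle (𝓡 4) M → ℝ) :
    Prop :=
  ∀ e ∈ IsManifold.maximalAtlas (𝓡 4) ∞ M, ∀ x ∈ e.target, ∀ y : Coord, ofCoord e x y ∈ A →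
    ∑ i, ∑ j, ((fundamentalTensor (inChart e F) x y)⁻¹ i j -
      3 / inChart e F x y ^ 2 * (y i * y j)) * finslerRicciTensor (inChart e F) i j x y = 0

/-- The vacuum Einstein equations: the Ricci tensor of `a` vanishes. -/
def SolvesEinsteinVacuum (a : PseudoRiemannianMetric M) : Prop :=
  ∀ e ∈ IsManifold.maximalAtlas (𝓡 4) ∞ M, ∀ x ∈ e.target, ∀ i j,
    ricci (a.components e) i j x = 0

/-- `b` is parallel with respect to the Levi-Civita connection of `a`:
`∇ᵢ bⱼ = ∂ᵢ bⱼ - Γᵏᵢⱼ bₖ = 0`. -/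
def IsParallel (a : PseudoRiemannianMetric M) (b : OneForm M) : Prop :=
  ∀ e ∈ IsManifold.maximalAtlas (𝓡 4) ∞ M, ∀ x ∈ e.target, ∀ i j,
    pd i (b.components e j) x -
      ∑ k, christoffel (a.components e) k i j x * b.components e k x = 0

end RandersSpacetime

end

/-!
Write `F = α + β` and let `N` be the Cartan connection of `F`. It satisfies
`∂F/∂xⁱ = Nᵐᵢ ∂F/∂yᵐ`. If `N` is a linear connection `Γ`, this identity reads
`2 α (∇b)(y) + (∇a)(y, y) = 0` for `y` in an open set, where `∇` belongs to `Γ`. Since `α` is not a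
rational function of `y`, both covariant derivatives vanish, so `Γ` is the Levi-Civita connection
and `b` is parallel. Conversely, if `b` is parallel then `F` is constant along the horizontal
directions of the Levi-Civita connection, and this determines the geodesic spray of `F`.

In the Berwald case the Finsler Ricci tensor is therefore the Ricci tensor of `a`, which annihilates
the vector dual to the parallel form `b`. As `g⁻¹` is a low-rank correction of a multiple of `a⁻¹`,
the field equation takes, after multiplication by `F³`, the form `α p₁ = p₂` with polynomials `p₁`,
`p₂` in `y`. Irrationality of `α` again gives `p₁ = p₂ = 0`, from which `Ric = λ (tr Ric) a` with
`λ = 1/3` or `λ = 1`. Taking the trace in dimension `4` would force `λ = 1/4` unless `Ric = 0`.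
-/

namespace RandersSpacetime

/-! ### Smooth functions -/

section Calculus

variable {𝕜 E F : Type*} [RCLike 𝕜] [NormedAddCommGroup E] [NormedSpace 𝕜 E]
  [NormedAddCommGroup F] [NormedSpace 𝕜 F]

theorem contDiffOn_fderiv_apply {f : E → F} {s : Set E} {m n : WithTop ℕ∞}
    (hf : ContDiffOn 𝕜 n f s) (hs : IsOpen s) (hmn : m + 1 ≤ n) (v : E) :
    ContDiffOn 𝕜 m (fun x => fderiv 𝕜 f x v) s :=
  (hf.fderiv_of_isOpen hs hmn).clm_apply contDiffOn_const

theorem fderiv_fderiv_apply_comm {f : E → F} {x : E} {n : WithTop ℕ∞} (hf : ContDiffAt 𝕜 n f x)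
    (hn : 2 ≤ n) (v w : E) :
    fderiv 𝕜 (fun z => fderiv 𝕜 f z v) x w = fderiv 𝕜 (fun z => fderiv 𝕜 f z w) x v := by
  have hd : DifferentiableAt 𝕜 (fderiv 𝕜 f) x :=
    (hf.fderiv_right (m := 1) (by simpa [one_add_one_eq_two] using hn)).differentiableAt one_ne_zero
  have apply_eq (u : E) : fderiv 𝕜 (fun z => fderiv 𝕜 f z u) x =
      (fderiv 𝕜 (fderiv 𝕜 f) x).flip u := by
    simpa using (hd.hasFDerivAt.clm_apply (hasFDerivAt_const u x)).fderiv
  rw [apply_eq, apply_eq]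
  exact hf.isSymmSndFDerivAt (by rwa [minSmoothness_of_isRCLikeNormedField]) w v

variable {ι : Type*} [Fintype ι] [DecidableEq ι]

theorem contDiffOn_det {s : Set E} {n : WithTop ℕ∞} {A : E → Matrix ι ι 𝕜}
    (hA : ∀ i j, ContDiffOn 𝕜 n (fun z => A z i j) s) : ContDiffOn 𝕜 n (fun z => (A z).det) s := by
  simp only [Matrix.det_apply]
  exact ContDiffOn.sum fun σ _ => (contDiffOn_prod fun i _ => hA _ _).const_smul _

theorem contDiffOn_matrix_inv {s : Set E} {n : WithTop ℕ∞} {A : E → Matrix ι ι 𝕜}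
    (hA : ∀ i j, ContDiffOn 𝕜 n (fun z => A z i j) s) (hdet : ∀ z ∈ s, (A z).det ≠ 0) (i j : ι) :
    ContDiffOn 𝕜 n (fun z => (A z)⁻¹ i j) s := by
  simp only [Matrix.inv_def, Matrix.smul_apply, Matrix.adjugate_apply, Ring.inverse_eq_inv',
    smul_eq_mul]
  refine ((contDiffOn_det hA).inv hdet).mul (contDiffOn_det fun k l => ?_)
  by_cases h : k = j
  · simpa [h] using contDiffOn_const
  · simpa [Matrix.updateRow_ne h] using hA k l

end Calculus

/-! ### Partial derivatives of functions, vectors and matrices -/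

section PartialDerivative

variable {U : Set Coord} {f g : Coord → ℝ} {x : Coord} {ι : Type*}

theorem contDiffOn_pd (hf : ContDiffOn ℝ ∞ f U) (hU : IsOpen U) (i : Fin 4) :
    ContDiffOn ℝ ∞ (pd i f) U :=
  contDiffOn_fderiv_apply hf hU (by simp) _

theorem pd_comm (hf : ContDiffAt ℝ 2 f x) (i j : Fin 4) : pd i (pd j f) x = pd j (pd i f) x :=
  fderiv_fderiv_apply_comm hf le_rfl _ _

theorem pd_congr (h : f =ᶠ[nhds x] g) (i : Fin 4) : pd i f x = pd i g x := by
  simp only [pd, h.fderiv_eq]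

theorem pd_const (c : ℝ) (i : Fin 4) : pd i (fun _ => c) x = 0 := by
  simp [pd]

theorem pd_const_mul (c : ℝ) (hf : DifferentiableAt ℝ f x) (i : Fin 4) :
    pd i (fun z => c * f z) x = c * pd i f x := by
  simp [pd, fderiv_const_mul hf]

theorem pd_add (hf : DifferentiableAt ℝ f x) (hg : DifferentiableAt ℝ g x) (i : Fin 4) :
    pd i (fun z => f z + g z) x = pd i f x + pd i g x := by
  simp [pd, fderiv_fun_add hf hg]

theorem pd_mul (hf : DifferentiableAt ℝ f x) (hg : DifferentiableAt ℝ g x) (i : Fin 4) :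
    pd i (fun z => f z * g z) x = pd i f x * g x + f x * pd i g x := by
  simp [pd, fderiv_fun_mul hf hg, mul_comm, add_comm]

theorem pd_sum {s : Finset ι} {f : ι → Coord → ℝ} (hf : ∀ k ∈ s, DifferentiableAt ℝ (f k) x)
    (i : Fin 4) : pd i (fun z => ∑ k ∈ s, f k z) x = ∑ k ∈ s, pd i (f k) x := by
  simp [pd, fderiv_fun_sum hf]

end PartialDerivative

section MatrixDerivative

variable {l m n : Type*} {x : Coord}

/-- The entrywise partial derivative `∂ₖ A` of a matrix-valued function. -/
noncomputable def pdMatrix (k : Fin 4) (A : Coord → Matrix m n ℝ) (x : Coord) : Matrix m n ℝ :=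
  Matrix.of fun i j => pd k (fun z => A z i j) x

/-- The entrywise partial derivative `∂ₖ v` of a vector-valued function. -/
noncomputable def pdVec (k : Fin 4) (v : Coord → n → ℝ) (x : Coord) : n → ℝ :=
  fun i => pd k (fun z => v z i) x

theorem pdMatrix_congr {A B : Coord → Matrix m n ℝ} (h : ∀ᶠ z in nhds x, A z = B z) (k : Fin 4) :
    pdMatrix k A x = pdMatrix k B x := by
  ext i j
  exact pd_congr (h.mono fun z hz => by simp only [hz]) k

theorem pdVec_congr {v w : Coord → n → ℝ} (h : ∀ᶠ z in nhds x, v z = w z) (k : Fin 4) :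
    pdVec k v x = pdVec k w x := by
  ext i
  exact pd_congr (h.mono fun z hz => by simp only [hz]) k

theorem pdMatrix_comm {A : Coord → Matrix m n ℝ}
    (hA : ∀ i j, ContDiffAt ℝ 2 (fun z => A z i j) x) (j k : Fin 4) :
    pdMatrix j (pdMatrix k A) x = pdMatrix k (pdMatrix j A) x := by
  ext p q
  exact pd_comm (hA p q) j k

theorem pdVec_comm {v : Coord → n → ℝ} (hv : ∀ i, ContDiffAt ℝ 2 (fun z => v z i) x)
    (j k : Fin 4) : pdVec j (pdVec k v) x = pdVec k (pdVec j v) x := by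
  ext p
  exact pd_comm (hv p) j k

theorem pdMatrix_transpose (k : Fin 4) (A : Coord → Matrix m n ℝ) :
    pdMatrix k (fun z => (A z)ᵀ) x = (pdMatrix k A x)ᵀ :=
  rfl

theorem pdMatrix_add {A B : Coord → Matrix m n ℝ}
    (hA : ∀ i j, DifferentiableAt ℝ (fun z => A z i j) x)
    (hB : ∀ i j, DifferentiableAt ℝ (fun z => B z i j) x) (k : Fin 4) :
    pdMatrix k (fun z => A z + B z) x = pdMatrix k A x + pdMatrix k B x := by
  ext i j
  exact pd_add (hA i j) (hB i j) k

variable [Fintype n]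

theorem differentiableAt_mul_apply {A : Coord → Matrix m n ℝ} {B : Coord → Matrix n l ℝ}
    (hA : ∀ i j, DifferentiableAt ℝ (fun z => A z i j) x)
    (hB : ∀ i j, DifferentiableAt ℝ (fun z => B z i j) x) (i : m) (j : l) :
    DifferentiableAt ℝ (fun z => (A z * B z) i j) x := by
  simpa only [Matrix.mul_apply] using
    DifferentiableAt.fun_sum fun r _ => (hA i r).fun_mul (hB r j)

theorem pdMatrix_mul {A : Coord → Matrix m n ℝ} {B : Coord → Matrix n l ℝ}
    (hA : ∀ i j, DifferentiableAt ℝ (fun z => A z i j) x)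
    (hB : ∀ i j, DifferentiableAt ℝ (fun z => B z i j) x) (k : Fin 4) :
    pdMatrix k (fun z => A z * B z) x = pdMatrix k A x * B x + A x * pdMatrix k B x := by
  ext i j
  simp only [pdMatrix, Matrix.of_apply, Matrix.mul_apply, Matrix.add_apply,
    ← Finset.sum_add_distrib]
  rw [pd_sum fun r _ => (hA i r).fun_mul (hB r j)]
  exact Finset.sum_congr rfl fun r _ => pd_mul (hA i r) (hB r j) k

theorem pdVec_mulVec {A : Coord → Matrix m n ℝ} {v : Coord → n → ℝ}
    (hA : ∀ i j, DifferentiableAt ℝ (fun z => A z i j) x)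
    (hv : ∀ i, DifferentiableAt ℝ (fun z => v z i) x) (k : Fin 4) :
    pdVec k (fun z => A z *ᵥ v z) x = pdMatrix k A x *ᵥ v x + A x *ᵥ pdVec k v x := by
  ext i
  simp only [pdMatrix, pdVec, Matrix.mulVec, dotProduct, Pi.add_apply, Matrix.of_apply,
    ← Finset.sum_add_distrib]
  rw [pd_sum fun r _ => (hA i r).fun_mul (hv r)]
  exact Finset.sum_congr rfl fun r _ => pd_mul (hA i r) (hv r) k

end MatrixDerivative

/-! ### Linear connections and their curvature -/

section Connection

variable {n : Type*} [Fintype n] {Γ : Fin 4 → Coord → Matrix n n ℝ} {x : Coord}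

/-- The curvature `∂ⱼΓₖ - ∂ₖΓⱼ + [Γⱼ, Γₖ]` of the connection `∂ₖ + Γₖ` on a trivial bundle. -/
noncomputable def curvatureMatrix (Γ : Fin 4 → Coord → Matrix n n ℝ) (j k : Fin 4) (x : Coord) :
    Matrix n n ℝ :=
  pdMatrix j (Γ k) x - pdMatrix k (Γ j) x + (Γ j x * Γ k x - Γ k x * Γ j x)

/-- The covariant derivative `∇ₖ b = ∂ₖ b - Γₖᵀ b` of a section of the dual bundle. -/
noncomputable def covDerivForm (Γ : Fin 4 → Coord → Matrix n n ℝ) (b : Coord → n → ℝ) (k : Fin 4)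
    (x : Coord) : n → ℝ :=
  pdVec k b x - (Γ k x)ᵀ *ᵥ b x

/-- The covariant derivative `∇ₖ a = ∂ₖ a - (a Γₖ + Γₖᵀ a)` of a field of bilinear forms. -/
noncomputable def covDerivMetric (Γ : Fin 4 → Coord → Matrix n n ℝ) (a : Coord → Matrix n n ℝ)
    (k : Fin 4) (x : Coord) : Matrix n n ℝ :=
  pdMatrix k a x - (a x * Γ k x + (Γ k x)ᵀ * a x)

theorem curvatureMatrix_transpose_mulVec_of_covDerivForm_eq_zero
    (hΓ : ∀ k p q, DifferentiableAt ℝ (fun z => Γ k z p q) x) {b : Coord → n → ℝ}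
    (hb : ∀ p, ContDiffAt ℝ 2 (fun z => b z p) x)
    (h : ∀ᶠ z in nhds x, ∀ k, covDerivForm Γ b k z = 0) (j k : Fin 4) :
    (curvatureMatrix Γ j k x)ᵀ *ᵥ b x = 0 := by
  have pdVec_eq (z : Coord) (hz : ∀ k, covDerivForm Γ b k z = 0) (k : Fin 4) :
      pdVec k b z = (Γ k z)ᵀ *ᵥ b z := sub_eq_zero.mp (hz k)
  have second (j k : Fin 4) : pdVec j (pdVec k b) x =
      ((pdMatrix j (Γ k) x)ᵀ + (Γ k x)ᵀ * (Γ j x)ᵀ) *ᵥ b x := by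
    have hΓt (p q : n) : DifferentiableAt ℝ (fun z => (Γ k z)ᵀ p q) x := hΓ k q p
    rw [pdVec_congr (h.mono fun z hz => pdVec_eq z hz k) j,
      pdVec_mulVec hΓt (fun p => (hb p).differentiableAt two_ne_zero),
      pdMatrix_transpose, pdVec_eq x h.self_of_nhds, Matrix.mulVec_mulVec, Matrix.add_mulVec]
  have hcomm := pdVec_comm hb j k
  rw [second, second, ← sub_eq_zero, ← Matrix.sub_mulVec] at hcomm
  rw [← hcomm, curvatureMatrix]
  congr 1
  simp only [Matrix.transpose_add, Matrix.transpose_sub, Matrix.transpose_mul]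
  abel

theorem mul_curvatureMatrix_of_covDerivMetric_eq_zero
    (hΓ : ∀ k p q, DifferentiableAt ℝ (fun z => Γ k z p q) x) {a : Coord → Matrix n n ℝ}
    (ha : ∀ p q, ContDiffAt ℝ 2 (fun z => a z p q) x)
    (h : ∀ᶠ z in nhds x, ∀ k, covDerivMetric Γ a k z = 0) (j k : Fin 4) :
    a x * curvatureMatrix Γ j k x = -((curvatureMatrix Γ j k x)ᵀ * a x) := by
  have pdMatrix_eq (z : Coord) (hz : ∀ k, covDerivMetric Γ a k z = 0) (k : Fin 4) :
      pdMatrix k a z = a z * Γ k z + (Γ k z)ᵀ * a z := sub_eq_zero.mp (hz k)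
  have hda (p q : n) : DifferentiableAt ℝ (fun z => a z p q) x :=
    (ha p q).differentiableAt two_ne_zero
  have second (j k : Fin 4) : pdMatrix j (pdMatrix k a) x =
      (a x * Γ j x + (Γ j x)ᵀ * a x) * Γ k x + a x * pdMatrix j (Γ k) x +
        ((pdMatrix j (Γ k) x)ᵀ * a x + (Γ k x)ᵀ * (a x * Γ j x + (Γ j x)ᵀ * a x)) := by
    have hΓt (p q : n) : DifferentiableAt ℝ (fun z => (Γ k z)ᵀ p q) x := hΓ k q p
    rw [pdMatrix_congr (h.mono fun z hz => pdMatrix_eq z hz k) j,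
      pdMatrix_add (differentiableAt_mul_apply hda (hΓ k)) (differentiableAt_mul_apply hΓt hda),
      pdMatrix_mul hda (hΓ k), pdMatrix_mul hΓt hda, pdMatrix_transpose,
      pdMatrix_eq x h.self_of_nhds]
  have hcomm := pdMatrix_comm ha j k
  rw [second, second, ← sub_eq_zero] at hcomm
  rw [← sub_eq_zero, sub_neg_eq_add, ← hcomm, curvatureMatrix]
  simp only [Matrix.transpose_add, Matrix.transpose_sub, Matrix.transpose_mul]
  noncomm_ring

/-- Torsion-freeness of a linear connection on the tangent bundle, `Γⁱⱼₖ = Γⁱₖⱼ` where the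
direction of differentiation is the index of `Γ` and the other two are those of the matrix. -/
def IsTorsionFreeAt (Γ : Fin 4 → Coord → Matrix (Fin 4) (Fin 4) ℝ) (x : Coord) : Prop :=
  ∀ i j k, Γ j x i k = Γ k x i j

theorem curvatureMatrix_bianchi {Γ : Fin 4 → Coord → Matrix (Fin 4) (Fin 4) ℝ}
    (h : ∀ᶠ z in nhds x, IsTorsionFreeAt Γ z) (i j k l : Fin 4) :
    curvatureMatrix Γ j k x i l + curvatureMatrix Γ k l x i j +
      curvatureMatrix Γ l j x i k = 0 := by
  have hpd (r j k : Fin 4) : pdMatrix r (Γ j) x i k = pdMatrix r (Γ k) x i j :=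
    pd_congr (h.mono fun z hz => hz i j k) r
  have hmul (j k l : Fin 4) : (Γ j x * Γ k x) i l = (Γ j x * Γ l x) i k := by
    simp only [Matrix.mul_apply, h.self_of_nhds _ k l]
  simp only [curvatureMatrix, Matrix.add_apply, Matrix.sub_apply]
  rw [hpd j l k, hpd k l j, hpd l k j, hmul j l k, hmul k l j, hmul l k j]
  ring

end Connection

/-! ### The Levi-Civita connection -/

section LeviCivita

variable {U : Set Coord} {a : Coord → Matrix (Fin 4) (Fin 4) ℝ} {x : Coord}

theorem trace_eq_zero_of_mul_eq_neg_transpose_mul {n : Type*} [Fintype n] [DecidableEq n]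
    {A C : Matrix n n ℝ} (hA : IsUnit A.det) (h : A * C = -(Cᵀ * A)) : C.trace = 0 := by
  have hC : C = -(A⁻¹ * (Cᵀ * A)) := by
    rw [← Matrix.mul_neg, ← h, Matrix.nonsing_inv_mul_cancel_left _ _ hA]
  have htr : C.trace = -C.trace := by
    conv_lhs => rw [hC, Matrix.trace_neg, Matrix.trace_mul_comm,
      Matrix.mul_nonsing_inv_cancel_right _ _ hA, Matrix.trace_transpose]
  linarith

/-- `a` is the component matrix of a pseudo-Riemannian metric on the open set `U`. -/
structure IsMetricOn (U : Set Coord) (a : Coord → Matrix (Fin 4) (Fin 4) ℝ) : Prop where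
  isOpen : IsOpen U
  contDiffOn : ∀ i j, ContDiffOn ℝ ∞ (fun x => a x i j) U
  isSymm : ∀ x ∈ U, (a x).IsSymm
  det_ne_zero : ∀ x ∈ U, (a x).det ≠ 0

/-- The connection matrices `(Γⱼ)ⁱₖ = Γⁱⱼₖ` of the Levi-Civita connection. -/
noncomputable def christoffelMatrix (a : Coord → Matrix (Fin 4) (Fin 4) ℝ) (j : Fin 4)
    (x : Coord) : Matrix (Fin 4) (Fin 4) ℝ :=
  Matrix.of fun i k => christoffel a i j k x

/-- The matrix of the Ricci tensor of the Levi-Civita connection. -/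
noncomputable def ricciMatrix (a : Coord → Matrix (Fin 4) (Fin 4) ℝ) (x : Coord) :
    Matrix (Fin 4) (Fin 4) ℝ :=
  Matrix.of fun i j => ricci a i j x

namespace IsMetricOn

variable (ha : IsMetricOn U a) (hx : x ∈ U)
include ha

theorem contDiffOn_christoffel (i j k : Fin 4) : ContDiffOn ℝ ∞ (christoffel a i j k) U := by
  have hpd (i j k : Fin 4) : ContDiffOn ℝ ∞ (pd k fun z => a z i j) U :=
    contDiffOn_pd (ha.contDiffOn i j) ha.isOpen k
  exact contDiffOn_const.mul (ContDiffOn.sum fun l _ =>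
    (contDiffOn_matrix_inv ha.contDiffOn ha.det_ne_zero i l).mul
      (((hpd l k j).add (hpd l j k)).sub (hpd j k l)))

include hx

theorem isUnit_det : IsUnit (a x).det :=
  isUnit_iff_ne_zero.mpr (ha.det_ne_zero x hx)

theorem contDiffAt (i j : Fin 4) : ContDiffAt ℝ 2 (fun z => a z i j) x :=
  ((ha.contDiffOn i j).contDiffAt (ha.isOpen.mem_nhds hx)).of_le ENat.LEInfty.out

theorem differentiableAt_christoffelMatrix (k i j : Fin 4) :
    DifferentiableAt ℝ (fun z => christoffelMatrix a k z i j) x :=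
  ((ha.contDiffOn_christoffel i k j).contDiffAt (ha.isOpen.mem_nhds hx)).differentiableAt (by simp)

theorem pdMatrix_isSymm (k : Fin 4) : (pdMatrix k a x).IsSymm := by
  rw [Matrix.IsSymm, ← pdMatrix_transpose]
  exact pdMatrix_congr (by filter_upwards [ha.isOpen.mem_nhds hx] with z hz using ha.isSymm z hz) k

theorem christoffelMatrix_isTorsionFreeAt : IsTorsionFreeAt (christoffelMatrix a) x := by
  intro i j k
  have hpd (l : Fin 4) : pd l (fun z => a z j k) x = pd l (fun z => a z k j) x :=
    (ha.pdMatrix_isSymm hx l).apply k j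
  simp only [christoffelMatrix, christoffel, Matrix.of_apply, hpd]
  congr 1
  exact Finset.sum_congr rfl fun l _ => by ring

theorem mul_christoffelMatrix_apply (i j k : Fin 4) : (a x * christoffelMatrix a k x) i j =
    (1 / 2) * (pdMatrix k a x i j + pdMatrix j a x i k - pdMatrix i a x k j) := by
  set lower : Fin 4 → ℝ := fun l =>
    (1 / 2) * (pdMatrix k a x l j + pdMatrix j a x l k - pdMatrix l a x k j)
  have hcol (p : Fin 4) : christoffelMatrix a k x p j = ((a x)⁻¹ *ᵥ lower) p := by
    simp only [christoffelMatrix, christoffel, Matrix.of_apply, Matrix.mulVec, dotProduct, lower,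
      pdMatrix, Finset.mul_sum]
    exact Finset.sum_congr rfl fun l _ => by ring
  calc (a x * christoffelMatrix a k x) i j
      = (a x *ᵥ ((a x)⁻¹ *ᵥ lower)) i := by
        simp only [Matrix.mul_apply, hcol]; rfl
    _ = lower i := by
        rw [Matrix.mulVec_mulVec, Matrix.mul_nonsing_inv _ (ha.isUnit_det hx), Matrix.one_mulVec]

theorem covDerivMetric_christoffelMatrix (k : Fin 4) :
    covDerivMetric (christoffelMatrix a) a k x = 0 := by
  have htrans : (christoffelMatrix a k x)ᵀ * a x = (a x * christoffelMatrix a k x)ᵀ := by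
    rw [Matrix.transpose_mul, ha.isSymm x hx]
  ext i j
  rw [covDerivMetric, htrans]
  simp only [Matrix.sub_apply, Matrix.add_apply, Matrix.transpose_apply,
    ha.mul_christoffelMatrix_apply hx, (ha.pdMatrix_isSymm hx _).apply i j,
    (ha.pdMatrix_isSymm hx _).apply i k, (ha.pdMatrix_isSymm hx _).apply j k, Matrix.zero_apply]
  ring

theorem eq_christoffelMatrix {Γ : Fin 4 → Coord → Matrix (Fin 4) (Fin 4) ℝ}
    (hΓ : IsTorsionFreeAt Γ x) (h : ∀ k, covDerivMetric Γ a k x = 0) (k : Fin 4) :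
    Γ k x = christoffelMatrix a k x := by
  have hpd (i j k : Fin 4) :
      pdMatrix k a x i j = (a x * Γ k x) i j + (a x * Γ k x) j i := by
    have htrans : (Γ k x)ᵀ * a x = (a x * Γ k x)ᵀ := by
      rw [Matrix.transpose_mul, ha.isSymm x hx]
    rw [sub_eq_zero.mp (h k), htrans, Matrix.add_apply, Matrix.transpose_apply]
  have hsymm (i j k : Fin 4) : (a x * Γ j x) i k = (a x * Γ k x) i j := by
    simp only [Matrix.mul_apply, hΓ _ j k]
  have hmul : a x * Γ k x = a x * christoffelMatrix a k x := by
    ext i j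
    rw [ha.mul_christoffelMatrix_apply hx, hpd, hpd, hpd, hsymm i j k, hsymm k i j, hsymm j i k]
    ring
  rw [← Matrix.nonsing_inv_mul_cancel_left _ (Γ k x) (ha.isUnit_det hx), hmul,
    Matrix.nonsing_inv_mul_cancel_left _ _ (ha.isUnit_det hx)]

theorem ricciMatrix_apply (l k : Fin 4) :
    ricciMatrix a x l k = ∑ i, curvatureMatrix (christoffelMatrix a) i k x i l := by
  have hsymm (i j k : Fin 4) : christoffel a i j k x = christoffel a i k j x :=
    ha.christoffelMatrix_isTorsionFreeAt hx i j k
  simp only [ricciMatrix, ricci, riemann, curvatureMatrix, Matrix.of_apply, Matrix.add_apply,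
    Matrix.sub_apply, Matrix.mul_apply, ← Finset.sum_sub_distrib]
  refine Finset.sum_congr rfl fun i _ => ?_
  congr 1
  refine Finset.sum_congr rfl fun m _ => ?_
  simp only [christoffelMatrix, Matrix.of_apply]
  rw [hsymm i m i, hsymm i m k]

theorem ricciMatrix_isSymm : (ricciMatrix a x).IsSymm := by
  have hnhds : ∀ᶠ z in nhds x, z ∈ U := ha.isOpen.mem_nhds hx
  ext k l
  have htrace : (curvatureMatrix (christoffelMatrix a) k l x).trace = 0 :=
    trace_eq_zero_of_mul_eq_neg_transpose_mul (ha.isUnit_det hx)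
      (mul_curvatureMatrix_of_covDerivMetric_eq_zero (ha.differentiableAt_christoffelMatrix hx)
        (ha.contDiffAt hx) (hnhds.mono fun z hz => ha.covDerivMetric_christoffelMatrix hz) k l)
  have hbianchi (i : Fin 4) := curvatureMatrix_bianchi
    (hnhds.mono fun z hz => ha.christoffelMatrix_isTorsionFreeAt hz) i i k l
  have hskew (i : Fin 4) : curvatureMatrix (christoffelMatrix a) l i x =
      -curvatureMatrix (christoffelMatrix a) i l x := by
    simp only [curvatureMatrix]; abel
  rw [Matrix.transpose_apply, ha.ricciMatrix_apply hx, ha.ricciMatrix_apply hx, ← sub_eq_zero,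
    ← Finset.sum_sub_distrib, ← neg_eq_zero, ← htrace, Matrix.trace, ← Finset.sum_neg_distrib]
  refine Finset.sum_congr rfl fun i _ => ?_
  have := hbianchi i
  simp only [hskew i, Matrix.neg_apply] at this
  rw [Matrix.diag_apply]
  linarith

theorem ricciMatrix_mulVec_dual_eq_zero {b : Coord → Fin 4 → ℝ}
    (hb : ∀ i, ContDiffOn ℝ ∞ (fun x => b x i) U)
    (h : ∀ z ∈ U, ∀ k, covDerivForm (christoffelMatrix a) b k z = 0) :
    ricciMatrix a x *ᵥ ((a x)⁻¹ *ᵥ b x) = 0 := by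
  have hnhds : ∀ᶠ z in nhds x, z ∈ U := ha.isOpen.mem_nhds hx
  set c := (a x)⁻¹ *ᵥ b x with hc
  have hac : a x *ᵥ c = b x := by
    rw [hc, Matrix.mulVec_mulVec, Matrix.mul_nonsing_inv _ (ha.isUnit_det hx), Matrix.one_mulVec]
  have hcurv (j k : Fin 4) : curvatureMatrix (christoffelMatrix a) j k x *ᵥ c = 0 := by
    refine Matrix.mulVec_injective_of_isUnit
      ((Matrix.isUnit_iff_isUnit_det _).mpr (ha.isUnit_det hx)) ?_
    rw [Matrix.mulVec_mulVec, mul_curvatureMatrix_of_covDerivMetric_eq_zero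
      (ha.differentiableAt_christoffelMatrix hx) (ha.contDiffAt hx)
      (hnhds.mono fun z hz => ha.covDerivMetric_christoffelMatrix hz), Matrix.neg_mulVec,
      ← Matrix.mulVec_mulVec, hac, curvatureMatrix_transpose_mulVec_of_covDerivForm_eq_zero
      (ha.differentiableAt_christoffelMatrix hx) _ (hnhds.mono h), neg_zero, Matrix.mulVec_zero]
    exact fun p => ((hb p).contDiffAt hnhds).of_le ENat.LEInfty.out
  ext k
  calc (ricciMatrix a x *ᵥ c) k
      = ∑ l, ∑ i, curvatureMatrix (christoffelMatrix a) i k x i l * c l := by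
        rw [Matrix.mulVec, dotProduct]
        refine Finset.sum_congr rfl fun l _ => ?_
        rw [← Finset.sum_mul, ← (ha.ricciMatrix_isSymm hx).apply, ha.ricciMatrix_apply hx]
    _ = ∑ i, (curvatureMatrix (christoffelMatrix a) i k x *ᵥ c) i := Finset.sum_comm
    _ = 0 := by simp [hcurv]

end IsMetricOn

end LeviCivita

/-! ### Functions on an open subset of the tangent bundle -/

section FibreDerivative

variable {x y : Coord}

theorem pd_dotProduct {n : Type*} [Fintype n] {v w : Coord → n → ℝ}
    (hv : ∀ i, DifferentiableAt ℝ (fun z => v z i) x)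
    (hw : ∀ i, DifferentiableAt ℝ (fun z => w z i) x) (k : Fin 4) :
    pd k (fun z => v z ⬝ᵥ w z) x = pdVec k v x ⬝ᵥ w x + v x ⬝ᵥ pdVec k w x := by
  simp only [dotProduct, pdVec, ← Finset.sum_add_distrib]
  rw [pd_sum fun r _ => (hv r).fun_mul (hw r)]
  exact Finset.sum_congr rfl fun r _ => pd_mul (hv r) (hw r) k

theorem pdVec_coord (k : Fin 4) : pdVec k (fun z : Coord => ⇑z) y = Pi.single k 1 := by
  ext i
  have hproj : HasFDerivAt (fun z : Coord => z i) (EuclideanSpace.proj i : Coord →L[ℝ] ℝ) y :=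
    (EuclideanSpace.proj i : Coord →L[ℝ] ℝ).hasFDerivAt
  simp [pdVec, pd, hproj.fderiv, Pi.single_apply]

theorem pdVec_const_mulVec {m n : Type*} [Fintype n] (A : Matrix m n ℝ) {v : Coord → n → ℝ}
    (hv : ∀ i, DifferentiableAt ℝ (fun z => v z i) x) (k : Fin 4) :
    pdVec k (fun z => A *ᵥ v z) x = A *ᵥ pdVec k v x := by
  have hA : pdMatrix k (fun _ : Coord => A) x = 0 := by
    ext i j
    exact pd_const _ k
  rw [pdVec_mulVec (A := fun _ => A) (fun _ _ => differentiableAt_const _) hv, hA,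
    Matrix.zero_mulVec, zero_add]

theorem pd_quadratic (A : Matrix (Fin 4) (Fin 4) ℝ) (k : Fin 4) :
    pd k (fun z : Coord => ⇑z ⬝ᵥ A *ᵥ z) y = (A *ᵥ y) k + (Aᵀ *ᵥ y) k := by
  have hcoord (i : Fin 4) : DifferentiableAt ℝ (fun z : Coord => z i) y := by fun_prop
  have hmul (i : Fin 4) : DifferentiableAt ℝ (fun z : Coord => (A *ᵥ z) i) y := by
    simp only [Matrix.mulVec, dotProduct]; fun_prop
  rw [pd_dotProduct hcoord hmul, pdVec_const_mulVec A hcoord, pdVec_coord, single_one_dotProduct,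
    Matrix.mulVec_single_one, dotProduct_comm]
  rfl

end FibreDerivative

/-- Smoothness on `D ⊆ U × ℝ⁴` of a curried function of `(x, y)`. -/
def SmoothOn (D : Set (Coord × Coord)) (f : Coord → Coord → ℝ) : Prop :=
  ContDiffOn ℝ ∞ (fun p : Coord × Coord => f p.1 p.2) D

namespace SmoothOn

variable {D : Set (Coord × Coord)} {f g : Coord → Coord → ℝ} {x y : Coord}

theorem fiberCoord (i : Fin 4) : SmoothOn D (fun _ y => y i) :=
  ((EuclideanSpace.proj i : Coord →L[ℝ] ℝ).contDiff.comp contDiff_snd).contDiffOn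

theorem of_base {U : Set Coord} {f : Coord → ℝ} (hf : ContDiffOn ℝ ∞ f U)
    (hD : ∀ p ∈ D, p.1 ∈ U) : SmoothOn D (fun x _ => f x) :=
  hf.comp contDiffOn_fst hD

variable (hD : IsOpen D) (h : (x, y) ∈ D) (hf : SmoothOn D f)
include hD hf

include h in
theorem hasFDerivAt : HasFDerivAt (fun p : Coord × Coord => f p.1 p.2)
    (fderiv ℝ (fun p : Coord × Coord => f p.1 p.2) (x, y)) (x, y) :=
  ((ContDiffOn.contDiffAt hf (hD.mem_nhds h)).differentiableAt (by simp)).hasFDerivAt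

include h in
theorem hasFDerivAt_left :
    HasFDerivAt (fun z => f z y) ((fderiv ℝ (fun p : Coord × Coord => f p.1 p.2) (x, y)).comp
      (ContinuousLinearMap.inl ℝ Coord Coord)) x :=
  HasFDerivAt.comp (f := fun z => (z, y)) x (hf.hasFDerivAt hD h) (hasFDerivAt_prodMk_left x y)

include h in
theorem hasFDerivAt_right :
    HasFDerivAt (f x) ((fderiv ℝ (fun p : Coord × Coord => f p.1 p.2) (x, y)).comp
      (ContinuousLinearMap.inr ℝ Coord Coord)) y :=
  HasFDerivAt.comp (f := fun z => (x, z)) y (hf.hasFDerivAt hD h) (hasFDerivAt_prodMk_right x y)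

include h in
theorem differentiableAt_left : DifferentiableAt ℝ (fun z => f z y) x :=
  (hf.hasFDerivAt_left hD h).differentiableAt

include h in
theorem differentiableAt_right : DifferentiableAt ℝ (f x) y :=
  (hf.hasFDerivAt_right hD h).differentiableAt

include h in
theorem dx_eq (i : Fin 4) : dx i f x y =
    fderiv ℝ (fun p : Coord × Coord => f p.1 p.2) (x, y) (EuclideanSpace.single i 1, 0) := by
  rw [dx, (hf.hasFDerivAt_left hD h).fderiv]
  rfl

include h in
theorem dy_eq (i : Fin 4) : dy i f x y =
    fderiv ℝ (fun p : Coord × Coord => f p.1 p.2) (x, y) (0, EuclideanSpace.single i 1) := by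
  rw [dy, (hf.hasFDerivAt_right hD h).fderiv]
  rfl

theorem smoothOn_dx (i : Fin 4) : SmoothOn D (dx i f) :=
  (contDiffOn_fderiv_apply hf hD (by simp) _).congr fun _ hp => hf.dx_eq hD hp i

theorem smoothOn_dy (i : Fin 4) : SmoothOn D (dy i f) :=
  (contDiffOn_fderiv_apply hf hD (by simp) _).congr fun _ hp => hf.dy_eq hD hp i

include h in
theorem dy_dx_comm (i j : Fin 4) : dy i (dx j f) x y = dx j (dy i f) x y := by
  have hdx : (fun p : Coord × Coord => dx j f p.1 p.2) =ᶠ[nhds (x, y)]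
      fun p => fderiv ℝ (fun p : Coord × Coord => f p.1 p.2) p (EuclideanSpace.single j 1, 0) := by
    filter_upwards [hD.mem_nhds h] with p hp using hf.dx_eq hD hp j
  have hdy : (fun p : Coord × Coord => dy i f p.1 p.2) =ᶠ[nhds (x, y)]
      fun p => fderiv ℝ (fun p : Coord × Coord => f p.1 p.2) p (0, EuclideanSpace.single i 1) := by
    filter_upwards [hD.mem_nhds h] with p hp using hf.dy_eq hD hp i
  rw [(hf.smoothOn_dx hD j).dy_eq hD h, (hf.smoothOn_dy hD i).dx_eq hD h, hdx.fderiv_eq,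
    hdy.fderiv_eq]
  exact fderiv_fderiv_apply_comm (ContDiffOn.contDiffAt hf (hD.mem_nhds h)) ENat.LEInfty.out _ _

omit hD in
theorem contDiffOn_right : ContDiffOn ℝ ∞ (f x) {z | (x, z) ∈ D} :=
  ContDiffOn.comp (g := fun p : Coord × Coord => f p.1 p.2) hf
    (contDiff_prodMk_right x).contDiffOn fun _ hz => hz

include h in
theorem dy_dy_comm (i j : Fin 4) : dy i (dy j f) x y = dy j (dy i f) x y :=
  pd_comm ((hf.contDiffOn_right.contDiffAt
    ((hD.preimage (Continuous.prodMk_right x)).mem_nhds h)).of_le ENat.LEInfty.out) i j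

end SmoothOn

section Congruence

variable {D : Set (Coord × Coord)} {f g : Coord → Coord → ℝ} {x y : Coord}

theorem dx_congr (hD : IsOpen D) (h : ∀ x y, (x, y) ∈ D → f x y = g x y) (hxy : (x, y) ∈ D)
    (i : Fin 4) : dx i f x y = dx i g x y :=
  pd_congr (by
    filter_upwards [(hD.preimage (Continuous.prodMk_left y)).mem_nhds hxy] with z hz
      using h z y hz) i

theorem dy_congr (hD : IsOpen D) (h : ∀ x y, (x, y) ∈ D → f x y = g x y) (hxy : (x, y) ∈ D)
    (i : Fin 4) : dy i f x y = dy i g x y :=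
  pd_congr (by
    filter_upwards [(hD.preimage (Continuous.prodMk_right x)).mem_nhds hxy] with z hz
      using h x z hz) i

end Congruence

/-! ### The Cartan connection of a Finsler function -/

/-- The vector `∂f/∂y` of fibre derivatives. -/
noncomputable def vertGrad (f : Coord → Coord → ℝ) (x y : Coord) : Fin 4 → ℝ :=
  fun i => dy i f x y

/-- The vector `∂f/∂x` of base derivatives. -/
noncomputable def baseGrad (f : Coord → Coord → ℝ) (x y : Coord) : Fin 4 → ℝ :=
  fun i => dx i f x y

/-- The Euler-Lagrange covector `yˡ ∂²f²/∂xˡ∂yᵏ - ∂f²/∂xᵏ` of the energy `f²`. -/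
noncomputable def sprayCovector (f : Coord → Coord → ℝ) (x y : Coord) : Fin 4 → ℝ :=
  fun k => (∑ l, y l * dx l (dy k (sqFun f)) x y) - dx k (sqFun f) x y

/-- The geodesic spray coefficients `g^{ik} (yˡ ∂²f²/∂xˡ∂yᵏ - ∂f²/∂xᵏ)`. -/
noncomputable def spray (f : Coord → Coord → ℝ) (x y : Coord) : Fin 4 → ℝ :=
  (fundamentalTensor f x y)⁻¹ *ᵥ sprayCovector f x y

theorem cartanConnection_eq_dy_spray (f : Coord → Coord → ℝ) (i j : Fin 4) (x y : Coord) :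
    cartanConnection f i j x y = (1 / 4) * dy j (fun x y => spray f x y i) x y :=
  rfl

/-- `f` is the coordinate expression of a Finsler function with nondegenerate fundamental tensor
on the open set `D` of points `(x, y)`; homogeneity enters through Euler's identity. -/
structure IsFinslerOn (D : Set (Coord × Coord)) (f : Coord → Coord → ℝ) : Prop where
  isOpen : IsOpen D
  smoothOn : SmoothOn D f
  euler : ∀ x y, (x, y) ∈ D → y ⬝ᵥ vertGrad f x y = f x y
  det_ne_zero : ∀ x y, (x, y) ∈ D → (fundamentalTensor f x y).det ≠ 0

namespace IsFinslerOn

variable {D : Set (Coord × Coord)} {f : Coord → Coord → ℝ} {x y : Coord}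
variable (hf : IsFinslerOn D f) (h : (x, y) ∈ D)
include hf

theorem smoothOn_sqFun : SmoothOn D (sqFun f) :=
  ContDiffOn.pow hf.smoothOn 2

theorem smoothOn_fundamentalTensor (i j : Fin 4) :
    SmoothOn D (fun x y => fundamentalTensor f x y i j) :=
  SmoothOn.smoothOn_dy hf.isOpen (SmoothOn.smoothOn_dy hf.isOpen
    (f := fun x y => (1 / 2 : ℝ) * f x y ^ 2) (contDiffOn_const.mul hf.smoothOn_sqFun) j) i

theorem smoothOn_spray (i : Fin 4) : SmoothOn D (fun x y => spray f x y i) := by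
  have hinv (k : Fin 4) : SmoothOn D (fun x y => (fundamentalTensor f x y)⁻¹ i k) :=
    contDiffOn_matrix_inv (A := fun p : Coord × Coord => fundamentalTensor f p.1 p.2)
      hf.smoothOn_fundamentalTensor (fun p hp => hf.det_ne_zero p.1 p.2 hp) i k
  have hcovector (k : Fin 4) : SmoothOn D (fun x y => sprayCovector f x y k) :=
    ContDiffOn.sub (ContDiffOn.sum fun l _ => (SmoothOn.fiberCoord l).mul
      ((hf.smoothOn_sqFun.smoothOn_dy hf.isOpen k).smoothOn_dx hf.isOpen l))
      (hf.smoothOn_sqFun.smoothOn_dx hf.isOpen k)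
  have hsum := ContDiffOn.sum (s := Finset.univ) fun k _ => (hinv k).mul (hcovector k)
  exact hsum

include h

theorem dx_sqFun (i : Fin 4) : dx i (sqFun f) x y = 2 * f x y * dx i f x y := by
  have hd := hf.smoothOn.differentiableAt_left hf.isOpen h
  have hsq : sqFun f = fun x y => f x y * f x y := by ext; simp only [sqFun, sq]
  rw [hsq]
  refine (pd_mul hd hd i).trans ?_
  simp only [dx, pd]
  ring

theorem dy_sqFun (i : Fin 4) : dy i (sqFun f) x y = 2 * f x y * dy i f x y := by
  have hd := hf.smoothOn.differentiableAt_right hf.isOpen h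
  have hsq : sqFun f = fun x y => f x y * f x y := by ext; simp only [sqFun, sq]
  rw [hsq]
  refine (pd_mul hd hd i).trans ?_
  simp only [dy, pd]
  ring

theorem fundamentalTensor_eq_hessian (i j : Fin 4) :
    dy i (dy j (sqFun f)) x y = 2 * fundamentalTensor f x y i j := by
  have hhalf (x y : Coord) (h : (x, y) ∈ D) :
      dy j (fun x y => (1 / 2 : ℝ) * f x y ^ 2) x y = (1 / 2) * dy j (sqFun f) x y :=
    pd_const_mul _ (hf.smoothOn_sqFun.differentiableAt_right hf.isOpen h) j
  have hg : fundamentalTensor f x y i j = (1 / 2) * dy i (dy j (sqFun f)) x y :=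
    (dy_congr hf.isOpen hhalf h i).trans
      (pd_const_mul _ ((hf.smoothOn_sqFun.smoothOn_dy hf.isOpen j).differentiableAt_right
        hf.isOpen h) i)
  rw [hg]
  ring

theorem fundamentalTensor_apply (i j : Fin 4) : fundamentalTensor f x y i j =
    dy i f x y * dy j f x y + f x y * dy i (dy j f) x y := by
  have hmul : dy i (fun x y => 2 * f x y * dy j f x y) x y =
      2 * dy i f x y * dy j f x y + 2 * f x y * dy i (dy j f) x y := by
    have hd := hf.smoothOn.differentiableAt_right hf.isOpen h
    refine (pd_mul (hd.const_mul 2)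
      ((hf.smoothOn.smoothOn_dy hf.isOpen j).differentiableAt_right hf.isOpen h) i).trans ?_
    rw [pd_const_mul 2 hd i]
    rfl
  have := hf.fundamentalTensor_eq_hessian h i j
  rw [dy_congr hf.isOpen (fun x y h => hf.dy_sqFun h j) h i, hmul] at this
  linarith

theorem isUnit_det : IsUnit (fundamentalTensor f x y).det :=
  isUnit_iff_ne_zero.mpr (hf.det_ne_zero x y h)

theorem ne_zero : f x y ≠ 0 := by
  intro h0
  have hg : fundamentalTensor f x y = Matrix.vecMulVec (vertGrad f x y) (vertGrad f x y) := by
    ext i j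
    rw [hf.fundamentalTensor_apply h, h0, zero_mul, add_zero]
    rfl
  exact hf.det_ne_zero x y h (by rw [hg, Matrix.det_vecMulVec])

theorem fundamentalTensor_isSymm : (fundamentalTensor f x y).IsSymm := by
  ext i j
  rw [Matrix.transpose_apply, hf.fundamentalTensor_apply h, hf.fundamentalTensor_apply h,
    hf.smoothOn.dy_dy_comm hf.isOpen h i j, mul_comm (dy i f x y)]

theorem sum_mul_dy_sqFun : ∑ k, y k * dy k (sqFun f) x y = 2 * sqFun f x y := by
  have heuler : ∑ k, y k * dy k f x y = f x y := hf.euler x y h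
  calc ∑ k, y k * dy k (sqFun f) x y = 2 * f x y * ∑ k, y k * dy k f x y := by
        simp only [hf.dy_sqFun h, Finset.mul_sum]
        exact Finset.sum_congr rfl fun k _ => by ring
    _ = 2 * sqFun f x y := by rw [heuler, sqFun]; ring

theorem vertGrad_sqFun :
    vertGrad (sqFun f) x y = (2 : ℝ) • (fundamentalTensor f x y *ᵥ y) := by
  ext i
  have hd (k : Fin 4) := (hf.smoothOn_sqFun.smoothOn_dy hf.isOpen k).differentiableAt_right
    hf.isOpen h
  have heuler : dy i (fun x y => ⇑y ⬝ᵥ vertGrad (sqFun f) x y) x y = 2 * dy i (sqFun f) x y :=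
    (dy_congr hf.isOpen (fun x y h => hf.sum_mul_dy_sqFun h) h i).trans
      (pd_const_mul 2 (hf.smoothOn_sqFun.differentiableAt_right hf.isOpen h) i)
  have hleibniz : dy i (fun x y => ⇑y ⬝ᵥ vertGrad (sqFun f) x y) x y =
      dy i (sqFun f) x y + 2 * (fundamentalTensor f x y *ᵥ y) i := by
    refine (pd_dotProduct (fun i => by fun_prop) hd i).trans ?_
    rw [pdVec_coord, single_one_dotProduct, dotProduct_comm, Matrix.mulVec, dotProduct,
      dotProduct, Finset.mul_sum]
    refine congr_arg _ (Finset.sum_congr rfl fun k _ => ?_)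
    rw [← mul_assoc, ← hf.fundamentalTensor_eq_hessian h]
    rfl
  simp only [vertGrad, Pi.smul_apply, smul_eq_mul]
  linarith

theorem dotProduct_sprayCovector :
    y ⬝ᵥ sprayCovector f x y = y ⬝ᵥ baseGrad (sqFun f) x y := by
  have hd (k : Fin 4) := (hf.smoothOn_sqFun.smoothOn_dy hf.isOpen k).differentiableAt_left
    hf.isOpen h
  have heuler (l : Fin 4) :
      ∑ k, y k * dx l (dy k (sqFun f)) x y = 2 * dx l (sqFun f) x y := by
    have hcongr : dx l (fun x y => ∑ k, y k * dy k (sqFun f) x y) x y =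
        2 * dx l (sqFun f) x y :=
      (dx_congr hf.isOpen (fun x y h => hf.sum_mul_dy_sqFun h) h l).trans
        (pd_const_mul 2 (hf.smoothOn_sqFun.differentiableAt_left hf.isOpen h) l)
    rw [← hcongr]
    exact ((pd_sum (fun k _ => (hd k).const_mul (y k)) l).trans
      (Finset.sum_congr rfl fun k _ => pd_const_mul (y k) (hd k) l)).symm
  have hsum : ∑ k, y k * ∑ l, y l * dx l (dy k (sqFun f)) x y =
      ∑ l, y l * (2 * dx l (sqFun f) x y) := by
    simp only [← heuler, Finset.mul_sum]
    rw [Finset.sum_comm]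
    exact Finset.sum_congr rfl fun l _ => Finset.sum_congr rfl fun k _ => by ring
  simp only [dotProduct, sprayCovector, baseGrad, mul_sub, Finset.sum_sub_distrib, hsum]
  rw [← Finset.sum_sub_distrib]
  exact Finset.sum_congr rfl fun l _ => by ring

theorem fundamentalTensor_mulVec_spray :
    fundamentalTensor f x y *ᵥ spray f x y = sprayCovector f x y := by
  rw [spray, Matrix.mulVec_mulVec, Matrix.mul_nonsing_inv _ (hf.isUnit_det h), Matrix.one_mulVec]

theorem vertGrad_sqFun_dotProduct_spray :
    vertGrad (sqFun f) x y ⬝ᵥ spray f x y = 2 * (y ⬝ᵥ baseGrad (sqFun f) x y) := by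
  rw [hf.vertGrad_sqFun h, smul_dotProduct, smul_eq_mul, ← hf.dotProduct_sprayCovector h,
    ← hf.fundamentalTensor_mulVec_spray h, dotProduct_comm, ← Matrix.dotProduct_transpose_mulVec,
    hf.fundamentalTensor_isSymm h]

theorem vertGrad_sqFun_dotProduct_dy_spray (i : Fin 4) :
    ∑ m, dy m (sqFun f) x y * dy i (fun x y => spray f x y m) x y = 4 * dx i (sqFun f) x y := by
  have hdG (m : Fin 4) := (hf.smoothOn_spray m).differentiableAt_right hf.isOpen h
  have hdy (m : Fin 4) := (hf.smoothOn_sqFun.smoothOn_dy hf.isOpen m).differentiableAt_right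
    hf.isOpen h
  have hdx (m : Fin 4) := (hf.smoothOn_sqFun.smoothOn_dx hf.isOpen m).differentiableAt_right
    hf.isOpen h
  have hleft : dy i (fun x y => vertGrad (sqFun f) x y ⬝ᵥ spray f x y) x y =
      2 * sprayCovector f x y i +
        ∑ m, dy m (sqFun f) x y * dy i (fun x y => spray f x y m) x y := by
    refine (pd_dotProduct hdy hdG i).trans (congr_arg (· + _) ?_)
    rw [← hf.fundamentalTensor_mulVec_spray h, Matrix.mulVec, dotProduct, dotProduct,
      Finset.mul_sum]
    refine Finset.sum_congr rfl fun m _ => ?_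
    rw [← mul_assoc, ← hf.fundamentalTensor_eq_hessian h]
    rfl
  have hright : dy i (fun x y => 2 * (⇑y ⬝ᵥ baseGrad (sqFun f) x y)) x y =
      2 * (dx i (sqFun f) x y + ∑ l, y l * dx l (dy i (sqFun f)) x y) := by
    have hd : DifferentiableAt ℝ (fun y : Coord => ⇑y ⬝ᵥ baseGrad (sqFun f) x y) y :=
      DifferentiableAt.fun_sum fun l _ => DifferentiableAt.fun_mul (by fun_prop) (hdx l)
    refine (pd_const_mul 2 hd i).trans (congr_arg (2 * ·) ?_)
    refine (pd_dotProduct (fun l => by fun_prop) hdx i).trans ?_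
    rw [pdVec_coord, single_one_dotProduct]
    refine congr_arg _ (Finset.sum_congr rfl fun l _ => ?_)
    rw [← hf.smoothOn_sqFun.dy_dx_comm hf.isOpen h]
    rfl
  have := dy_congr hf.isOpen (fun x y h => hf.vertGrad_sqFun_dotProduct_spray h) h i
  rw [hleft, hright, sprayCovector] at this
  linarith

theorem sum_cartanConnection_mul_dy (i : Fin 4) :
    ∑ m, cartanConnection f m i x y * dy m f x y = dx i f x y := by
  have hne : 2 * f x y ≠ 0 := mul_ne_zero two_ne_zero (hf.ne_zero h)
  have hscaled : 4 * (2 * f x y * dx i f x y) =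
      4 * (2 * f x y * ∑ m, cartanConnection f m i x y * dy m f x y) := by
    rw [← hf.dx_sqFun h, ← hf.vertGrad_sqFun_dotProduct_dy_spray h i, Finset.mul_sum,
      Finset.mul_sum]
    refine Finset.sum_congr rfl fun m _ => ?_
    rw [hf.dy_sqFun h, cartanConnection_eq_dy_spray]
    ring
  exact (mul_left_cancel₀ hne (mul_left_cancel₀ four_ne_zero hscaled)).symm

end IsFinslerOn

/-! ### Berwald functions -/

/-- The Cartan connection of `f` is the linear connection `Γ`: `Nⁱⱼ(x, y) = (Γⱼ)ⁱₖ(x) yᵏ` on `D`. -/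
def IsBerwaldOn (D : Set (Coord × Coord)) (f : Coord → Coord → ℝ)
    (Γ : Fin 4 → Coord → Matrix (Fin 4) (Fin 4) ℝ) : Prop :=
  ∀ x y, (x, y) ∈ D → ∀ i j, cartanConnection f i j x y = (Γ j x *ᵥ y) i

section Berwald

variable {D : Set (Coord × Coord)} {f : Coord → Coord → ℝ}
  {Γ : Fin 4 → Coord → Matrix (Fin 4) (Fin 4) ℝ} {x y : Coord}

theorem differentiableAt_coord (i : Fin 4) : DifferentiableAt ℝ (fun z : Coord => z i) y := by
  fun_prop

theorem differentiableAt_mulVec_coord {m : Type*} (A : Matrix m (Fin 4) ℝ) (i : m) :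
    DifferentiableAt ℝ (fun z : Coord => (A *ᵥ z) i) y := by
  simp only [Matrix.mulVec, dotProduct]
  fun_prop

theorem pd_mulVec_coord {m : Type*} (A : Matrix m (Fin 4) ℝ) (i : m) (k : Fin 4) :
    pd k (fun z : Coord => (A *ᵥ z) i) y = A i k := by
  have h := congr_fun (pdVec_const_mulVec A (differentiableAt_coord (y := y)) k) i
  rwa [pdVec_coord, Matrix.mulVec_single_one] at h

namespace IsBerwaldOn

theorem dx_eq (hf : IsFinslerOn D f) (hB : IsBerwaldOn D f Γ) (h : (x, y) ∈ D) (i : Fin 4) :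
    dx i f x y = (Γ i x *ᵥ y) ⬝ᵥ vertGrad f x y := by
  rw [← hf.sum_cartanConnection_mul_dy h i]
  exact Finset.sum_congr rfl fun m _ => by rw [hB x y h]; rfl

theorem isTorsionFreeAt (hf : IsFinslerOn D f) (hB : IsBerwaldOn D f Γ) (h : (x, y) ∈ D) :
    IsTorsionFreeAt Γ x := by
  have hdy (i j k : Fin 4) :
      Γ j x i k = (1 / 4) * dy k (dy j (fun x y => spray f x y i)) x y := by
    rw [← pd_mulVec_coord (y := y) (Γ j x) i k]
    exact (dy_congr hf.isOpen (fun x y h => (hB x y h i j).symm) h k).trans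
      (pd_const_mul _ (((hf.smoothOn_spray i).smoothOn_dy hf.isOpen j).differentiableAt_right
        hf.isOpen h) k)
  intro i j k
  rw [hdy i j k, hdy i k j, (hf.smoothOn_spray i).dy_dy_comm hf.isOpen h]

end IsBerwaldOn

section HorizontallyConstant

variable (hf : IsFinslerOn D f)
  (hdx : ∀ x y, (x, y) ∈ D → ∀ i, dx i f x y = (Γ i x *ᵥ y) ⬝ᵥ vertGrad f x y)
include hf hdx

theorem dx_sqFun_of_dx_eq (h : (x, y) ∈ D) (i : Fin 4) :
    dx i (sqFun f) x y = (Γ i x *ᵥ y) ⬝ᵥ vertGrad (sqFun f) x y := by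
  have hgrad : vertGrad (sqFun f) x y = (2 * f x y) • vertGrad f x y :=
    funext fun m => hf.dy_sqFun h m
  rw [hf.dx_sqFun h, hdx x y h, hgrad, dotProduct_smul, smul_eq_mul]

theorem dx_dy_sqFun_of_dx_eq (h : (x, y) ∈ D) (i k : Fin 4) :
    dx i (dy k (sqFun f)) x y = ((Γ i x)ᵀ *ᵥ vertGrad (sqFun f) x y) k +
      2 * (fundamentalTensor f x y *ᵥ (Γ i x *ᵥ y)) k := by
  have hdy (m : Fin 4) := (hf.smoothOn_sqFun.smoothOn_dy hf.isOpen m).differentiableAt_right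
    hf.isOpen h
  rw [← hf.smoothOn_sqFun.dy_dx_comm hf.isOpen h,
    dy_congr hf.isOpen (fun x y h => dx_sqFun_of_dx_eq hf hdx h i) h]
  refine (pd_dotProduct (differentiableAt_mulVec_coord (Γ i x)) hdy k).trans ?_
  congr 1
  · exact Finset.sum_congr rfl fun m _ => congr_arg (· * _) (pd_mulVec_coord (Γ i x) m k)
  · rw [Matrix.mulVec, dotProduct, dotProduct, Finset.mul_sum]
    refine Finset.sum_congr rfl fun m _ => ?_
    rw [← mul_assoc, ← hf.fundamentalTensor_eq_hessian h, mul_comm]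
    rfl

theorem spray_eq_of_dx_eq (hΓ : IsTorsionFreeAt Γ x) (h : (x, y) ∈ D) :
    spray f x y = (2 : ℝ) • ∑ l, y l • Γ l x *ᵥ y := by
  have hvert (k : Fin 4) : ∑ l, y l * ((Γ l x)ᵀ *ᵥ vertGrad (sqFun f) x y) k =
      dx k (sqFun f) x y := by
    simp only [dx_sqFun_of_dx_eq hf hdx h, Matrix.mulVec, dotProduct, Matrix.transpose_apply,
      Finset.mul_sum, Finset.sum_mul]
    rw [Finset.sum_comm]
    refine Finset.sum_congr rfl fun m _ => Finset.sum_congr rfl fun l _ => ?_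
    rw [hΓ m l k]
    ring
  have hcovector : sprayCovector f x y =
      fundamentalTensor f x y *ᵥ ((2 : ℝ) • ∑ l, y l • Γ l x *ᵥ y) := by
    ext k
    simp only [sprayCovector, dx_dy_sqFun_of_dx_eq hf hdx h, mul_add, Finset.sum_add_distrib,
      hvert k, Matrix.mulVec_smul, Matrix.mulVec_sum, Pi.smul_apply, Finset.sum_apply,
      smul_eq_mul, Finset.mul_sum]
    rw [add_sub_cancel_left]
    exact Finset.sum_congr rfl fun l _ => by ring
  rw [spray, hcovector, Matrix.mulVec_mulVec, Matrix.nonsing_inv_mul _ (hf.isUnit_det h),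
    Matrix.one_mulVec]

theorem isBerwaldOn_of_dx_eq (hΓ : ∀ x y, (x, y) ∈ D → IsTorsionFreeAt Γ x) :
    IsBerwaldOn D f Γ := by
  intro x y h i j
  let S (x : Coord) : Matrix (Fin 4) (Fin 4) ℝ := Matrix.of fun l k => Γ l x i k
  have hsymm : (S x)ᵀ = S x := by
    ext l k
    exact hΓ x y h i k l
  have hquad (x y : Coord) (h : (x, y) ∈ D) : spray f x y i = 2 * (⇑y ⬝ᵥ S x *ᵥ y) := by
    rw [spray_eq_of_dx_eq hf hdx (hΓ x y h) h]
    simp only [Pi.smul_apply, Finset.sum_apply, smul_eq_mul]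
    rfl
  have hd : DifferentiableAt ℝ (fun z : Coord => ⇑z ⬝ᵥ S x *ᵥ z) y :=
    DifferentiableAt.fun_sum fun l _ =>
      (differentiableAt_coord l).fun_mul (differentiableAt_mulVec_coord (S x) l)
  calc cartanConnection f i j x y
      = (1 / 4) * dy j (fun x y => 2 * (⇑y ⬝ᵥ S x *ᵥ y)) x y := by
        rw [cartanConnection_eq_dy_spray, dy_congr hf.isOpen hquad h]
    _ = (1 / 4) * (2 * (2 * (S x *ᵥ y) j)) := by
        refine congr_arg _ ((pd_const_mul 2 hd j).trans ?_)
        rw [pd_quadratic, hsymm, ← two_mul]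
    _ = (S x *ᵥ y) j := by ring
    _ = (Γ j x *ᵥ y) i := rfl

end HorizontallyConstant

/-! ### The Finsler Ricci tensor of a Berwald function -/

namespace IsBerwaldOn

variable (hD : IsOpen D) (hB : IsBerwaldOn D f Γ)
include hD hB

theorem horizontalDeriv_cartanConnection (h : (x, y) ∈ D)
    (hΓ : ∀ k i j, DifferentiableAt ℝ (fun z => Γ k z i j) x) (i j k : Fin 4) :
    horizontalDeriv f j (cartanConnection f i k) x y =
      ((pdMatrix j (Γ k) x - Γ k x * Γ j x) *ᵥ y) i := by
  have hdx : dx j (cartanConnection f i k) x y = (pdMatrix j (Γ k) x *ᵥ y) i := by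
    have hmul := congr_fun (pdVec_mulVec (v := fun _ : Coord => ⇑y) (hΓ k)
      (fun _ => differentiableAt_const _) j) i
    have hy : pdVec j (fun _ : Coord => ⇑y) x = 0 := funext fun r => pd_const (y r) j
    rw [hy, Matrix.mulVec_zero, add_zero] at hmul
    exact (dx_congr hD (fun x y h => hB x y h i k) h j).trans hmul
  have hdy (m : Fin 4) : dy m (cartanConnection f i k) x y = Γ k x i m :=
    (dy_congr hD (fun x y h => hB x y h i k) h m).trans (pd_mulVec_coord (Γ k x) i m)
  rw [horizontalDeriv, hdx, Matrix.sub_mulVec, ← Matrix.mulVec_mulVec, Pi.sub_apply,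
    Matrix.mulVec, Matrix.mulVec, dotProduct, dotProduct]
  refine congr_arg (_ - ·) (Finset.sum_congr rfl fun m _ => ?_)
  rw [hB x y h, hdy, mul_comm]

theorem finslerCurvature_eq (h : (x, y) ∈ D)
    (hΓ : ∀ k i j, DifferentiableAt ℝ (fun z => Γ k z i j) x) (i j k : Fin 4) :
    finslerCurvature f i j k x y = (curvatureMatrix Γ j k x *ᵥ y) i := by
  rw [finslerCurvature, hB.horizontalDeriv_cartanConnection hD h hΓ,
    hB.horizontalDeriv_cartanConnection hD h hΓ, ← Pi.sub_apply, ← Matrix.sub_mulVec,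
    curvatureMatrix]
  congr 2
  abel

end IsBerwaldOn

variable {U : Set Coord} {a : Coord → Matrix (Fin 4) (Fin 4) ℝ}

theorem finslerRicciTensor_eq_ricciMatrix (ha : IsMetricOn U a) (hD : IsOpen D)
    (hDU : ∀ x y, (x, y) ∈ D → x ∈ U) (hB : IsBerwaldOn D f (christoffelMatrix a))
    (h : (x, y) ∈ D) (i j : Fin 4) :
    finslerRicciTensor f i j x y = ricciMatrix a x i j := by
  have hRic (x y : Coord) (h : (x, y) ∈ D) :
      finslerRic f x y = ⇑y ⬝ᵥ (ricciMatrix a x)ᵀ *ᵥ y := by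
    have hx := hDU x y h
    simp only [finslerRic,
      hB.finslerCurvature_eq hD h (ha.differentiableAt_christoffelMatrix hx), Matrix.mulVec,
      dotProduct, Matrix.transpose_apply, ha.ricciMatrix_apply hx, Finset.sum_mul, Finset.mul_sum]
    rw [Finset.sum_comm]
    refine Finset.sum_congr rfl fun k _ => ?_
    rw [Finset.sum_comm]
    exact Finset.sum_congr rfl fun l _ => Finset.sum_congr rfl fun r _ => mul_comm _ _
  have hfirst (x y : Coord) (h : (x, y) ∈ D) :
      dy j (finslerRic f) x y = 2 * (ricciMatrix a x *ᵥ y) j := by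
    refine (dy_congr hD hRic h j).trans ((pd_quadratic _ j).trans ?_)
    rw [Matrix.transpose_transpose, ha.ricciMatrix_isSymm (hDU x y h), ← two_mul]
  have hsecond : dy i (dy j (finslerRic f)) x y = 2 * ricciMatrix a x j i := by
    refine (dy_congr hD hfirst h i).trans ?_
    refine (pd_const_mul 2 (differentiableAt_mulVec_coord (ricciMatrix a x) j) i).trans ?_
    rw [pd_mulVec_coord]
  rw [finslerRicciTensor, hsecond, (ha.ricciMatrix_isSymm (hDU x y h)).apply]
  ring

end Berwald

/-! ### Irrationality of the square root of a quadratic form -/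

section Irrationality

variable {E : Type*} [NormedAddCommGroup E] [NormedSpace ℝ E] {q p₁ p₂ : E → ℝ} {z : E}

theorem eq_zero_of_eventually_eq_zero {p : E → ℝ} (hp : ContDiff ℝ ω p)
    (h : ∀ᶠ w in nhds z, p w = 0) : p = 0 :=
  AnalyticOnNhd.eq_of_eventuallyEq (fun _ _ => hp.contDiffAt.analyticAt)
    (fun _ _ => analyticAt_const) h

theorem eq_zero_of_sqrt_mul_eq_of_neg (hq : ContDiff ℝ ω q) (h₁ : ContDiff ℝ ω p₁)
    (h₂ : ContDiff ℝ ω p₂) {v : E} (hv : q v < 0)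
    (h : ∀ᶠ w in nhds z, 0 < q w ∧ √(q w) * p₁ w = p₂ w) : p₁ = 0 ∧ p₂ = 0 := by
  have hsq : (fun w => q w * p₁ w ^ 2 - p₂ w ^ 2) = 0 := by
    refine eq_zero_of_eventually_eq_zero (z := z) (by fun_prop) ?_
    filter_upwards [h] with w hw
    rw [← hw.2, mul_pow, Real.sq_sqrt hw.1.le, sub_self]
  have hzero : ∀ᶠ w in nhds v, p₁ w = 0 ∧ p₂ w = 0 := by
    filter_upwards [hq.continuous.continuousAt.eventually_lt_const hv] with w hw
    have hw' : q w * p₁ w ^ 2 - p₂ w ^ 2 = 0 := congrFun hsq w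
    have h₁' : p₁ w ^ 2 = 0 := by nlinarith [sq_nonneg (p₁ w), sq_nonneg (p₂ w)]
    have h₂' : p₂ w ^ 2 = 0 := by nlinarith [sq_nonneg (p₁ w), sq_nonneg (p₂ w)]
    exact ⟨pow_eq_zero_iff two_ne_zero |>.1 h₁', pow_eq_zero_iff two_ne_zero |>.1 h₂'⟩
  exact ⟨eq_zero_of_eventually_eq_zero h₁ (hzero.mono fun _ h => h.1),
    eq_zero_of_eventually_eq_zero h₂ (hzero.mono fun _ h => h.2)⟩

/-- The complement of the origin is connected, so the identity propagates from `w` to `-w`, where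
the opposite parities reverse its sign. -/
theorem eq_zero_of_sqrt_mul_eq_of_pos (hE : 1 < Module.rank ℝ E) (hq : ContDiff ℝ ω q)
    (h₁ : ContDiff ℝ ω p₁) (h₂ : ContDiff ℝ ω p₂) (hpos : ∀ w ≠ 0, 0 < q w)
    (hq_even : ∀ w, q (-w) = q w) {ε : ℝ} (hε : ε ≠ 0) (hp₁ : ∀ w, p₁ (-w) = ε * p₁ w)
    (hp₂ : ∀ w, p₂ (-w) = -(ε * p₂ w)) (hz : z ≠ 0)
    (h : ∀ᶠ w in nhds z, √(q w) * p₁ w = p₂ w) : p₁ = 0 ∧ p₂ = 0 := by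
  have hsqrt : Set.EqOn (fun w => √(q w) * p₁ w) p₂ {0}ᶜ :=
    AnalyticOnNhd.eqOn_of_preconnected_of_eventuallyEq
      (fun w hw => ((hq.contDiffAt.sqrt (hpos w hw).ne').mul h₁.contDiffAt).analyticAt)
      (fun _ _ => h₂.contDiffAt.analyticAt)
      (isConnected_compl_singleton_of_one_lt_rank hE 0).isPreconnected hz h
  have hp₂_zero : ∀ w ≠ 0, p₂ w = 0 := fun w hw => by
    have hw' : √(q w) * p₁ w = p₂ w := hsqrt hw
    have hneg : √(q (-w)) * p₁ (-w) = p₂ (-w) := hsqrt (neg_ne_zero.2 hw)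
    rw [hq_even, hp₁, hp₂, mul_left_comm, hw', ← mul_neg] at hneg
    linarith [mul_left_cancel₀ hε hneg]
  have hp₁_zero : ∀ w ≠ 0, p₁ w = 0 := fun w hw =>
    (mul_eq_zero.1 ((hsqrt hw).trans (hp₂_zero w hw))).resolve_left
      (Real.sqrt_pos.2 (hpos w hw)).ne'
  have hne : ∀ᶠ w in nhds z, w ≠ 0 := isOpen_ne.mem_nhds hz
  exact ⟨eq_zero_of_eventually_eq_zero h₁ (hne.mono hp₁_zero),
    eq_zero_of_eventually_eq_zero h₂ (hne.mono hp₂_zero)⟩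

end Irrationality

section Forms

variable {n : Type*} [Fintype n]

theorem contDiff_dotProduct (b : n → ℝ) {k : WithTop ℕ∞} :
    ContDiff ℝ k (fun y : EuclideanSpace ℝ n => b ⬝ᵥ ⇑y) := by
  simp only [dotProduct]
  fun_prop

theorem contDiff_quadratic (A : Matrix n n ℝ) {k : WithTop ℕ∞} :
    ContDiff ℝ k (fun y : EuclideanSpace ℝ n => ⇑y ⬝ᵥ A *ᵥ y) := by
  simp only [Matrix.mulVec, dotProduct]
  fun_prop

theorem eq_zero_of_isSymm_of_quadratic_eq_zero {A : Matrix n n ℝ} (hA : A.IsSymm)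
    (h : ∀ v, v ⬝ᵥ A *ᵥ v = 0) : A = 0 := by
  classical
  have hpolar (v w : n → ℝ) : w ⬝ᵥ A *ᵥ v = 0 := by
    have hsymm : v ⬝ᵥ A *ᵥ w = w ⬝ᵥ A *ᵥ v := by
      rw [Matrix.dotProduct_mulVec, ← Matrix.mulVec_transpose, hA.eq, dotProduct_comm]
    have := h (v + w)
    simp only [Matrix.mulVec_add, dotProduct_add, add_dotProduct, h, hsymm] at this
    linarith
  exact Matrix.ext_of_mulVec_single fun i => by
    rw [Matrix.zero_mulVec]
    exact dotProduct_eq_zero _ fun w => (dotProduct_comm _ _).trans (hpolar _ w)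

theorem posDef_of_isSymm_of_nonneg [DecidableEq n] {A : Matrix n n ℝ} (hA : A.IsSymm)
    (hdet : A.det ≠ 0) (h : ∀ v, 0 ≤ v ⬝ᵥ A *ᵥ v) : A.PosDef :=
  (Matrix.PosSemidef.of_dotProduct_mulVec_nonneg hA h).posDef_iff_det_ne_zero.2 hdet

theorem eq_zero_of_sqrt_quadratic_mul_eq [DecidableEq n] [Nontrivial n] {A : Matrix n n ℝ}
    (hA : A.IsSymm) (hdet : A.det ≠ 0) {p₁ p₂ : EuclideanSpace ℝ n → ℝ}
    (h₁ : ContDiff ℝ ω p₁) (h₂ : ContDiff ℝ ω p₂) {ε : ℝ} (hε : ε ≠ 0)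
    (hp₁ : ∀ w, p₁ (-w) = ε * p₁ w) (hp₂ : ∀ w, p₂ (-w) = -(ε * p₂ w))
    {z : EuclideanSpace ℝ n}
    (h : ∀ᶠ w : EuclideanSpace ℝ n in nhds z,
      0 < ⇑w ⬝ᵥ A *ᵥ w ∧ √(⇑w ⬝ᵥ A *ᵥ w) * p₁ w = p₂ w) :
    p₁ = 0 ∧ p₂ = 0 := by
  by_cases hneg : ∃ v, v ⬝ᵥ A *ᵥ v < 0
  · obtain ⟨v, hv⟩ := hneg
    exact eq_zero_of_sqrt_mul_eq_of_neg (v := WithLp.toLp 2 v) (contDiff_quadratic A) h₁ h₂ hv h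
  · push Not at hneg
    have hpos := posDef_of_isSymm_of_nonneg hA hdet hneg
    refine eq_zero_of_sqrt_mul_eq_of_pos ?_ (contDiff_quadratic A) h₁ h₂ (fun w hw => ?_)
      (fun w => ?_) hε hp₁ hp₂ ?_ (h.mono fun _ hw => hw.2)
    · rw [rank_eq_card_basis (EuclideanSpace.basisFun n ℝ).toBasis]
      exact_mod_cast Fintype.one_lt_card
    · exact hpos.dotProduct_mulVec_pos (x := w.ofLp) (by simpa using hw)
    · simp [Matrix.mulVec_neg]
    · rintro rfl
      simpa using h.self_of_nhds.1

end Forms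

/-! ### Randers metrics of Berwald type -/

/-- The vector `y / √(A(y, y))` of unit length with respect to the bilinear form `A`. -/
noncomputable def unitVec {n : Type*} [Fintype n] (A : Matrix n n ℝ) (y : n → ℝ) : n → ℝ :=
  (√(y ⬝ᵥ A *ᵥ y))⁻¹ • y

theorem unitVec_dotProduct_mulVec {n : Type*} [Fintype n] {A : Matrix n n ℝ} {y : n → ℝ}
    (hy : 0 < y ⬝ᵥ A *ᵥ y) : unitVec A y ⬝ᵥ A *ᵥ unitVec A y = 1 := by
  have hsqrt := Real.mul_self_sqrt hy.le
  rw [unitVec, Matrix.mulVec_smul, smul_dotProduct, dotProduct_smul, smul_eq_mul, smul_eq_mul,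
    ← mul_assoc, ← mul_inv, hsqrt, inv_mul_cancel₀ hy.ne']

theorem pd_sqrt {f : Coord → ℝ} {x : Coord} (hf : DifferentiableAt ℝ f x) (hx : f x ≠ 0)
    (i : Fin 4) : pd i (fun z => √(f z)) x = pd i f x / (2 * √(f x)) := by
  rw [pd, (hf.hasFDerivAt.sqrt hx).fderiv, pd, smul_apply, smul_eq_mul]
  ring

theorem pd_sqrt_quadratic {A : Matrix (Fin 4) (Fin 4) ℝ} (hA : A.IsSymm) {y : Coord}
    (hy : 0 < y ⬝ᵥ A *ᵥ y) (k : Fin 4) :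
    pd k (fun z : Coord => √(z ⬝ᵥ A *ᵥ z)) y = (A *ᵥ unitVec A y) k := by
  have hq : DifferentiableAt ℝ (fun z : Coord => ⇑z ⬝ᵥ A *ᵥ z) y :=
    (contDiff_quadratic (k := 1) A).differentiable (by simp) y
  rw [pd_sqrt hq hy.ne', pd_quadratic, hA, unitVec, Matrix.mulVec_smul, Pi.smul_apply,
    smul_eq_mul]
  ring

/-- The Randers function `√(a(y, y)) + b(y)` of the metric `a` and the one-form `b`. -/
noncomputable def randers (a : Coord → Matrix (Fin 4) (Fin 4) ℝ) (b : Coord → Fin 4 → ℝ)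
    (x y : Coord) : ℝ :=
  √(y ⬝ᵥ a x *ᵥ y) + b x ⬝ᵥ y

/-- `f` is the coordinate expression over the chart domain `U` of a Randers metric with
nondegenerate fundamental tensor, defined on the open set `D` of points `(x, y)`. -/
structure IsRandersOn (U : Set Coord) (D : Set (Coord × Coord)) (f : Coord → Coord → ℝ)
    (a : Coord → Matrix (Fin 4) (Fin 4) ℝ) (b : Coord → Fin 4 → ℝ) : Prop where
  isMetricOn : IsMetricOn U a
  contDiffOn_form : ∀ i, ContDiffOn ℝ ∞ (fun x => b x i) U
  isOpen : IsOpen D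
  fst_mem : ∀ x y, (x, y) ∈ D → x ∈ U
  exists_mem : ∀ x ∈ U, ∃ y, (x, y) ∈ D
  quadratic_pos : ∀ x y, (x, y) ∈ D → 0 < y ⬝ᵥ a x *ᵥ y
  eq_randers : ∀ x y, (x, y) ∈ D → f x y = randers a b x y
  det_ne_zero : ∀ x y, (x, y) ∈ D → (fundamentalTensor f x y).det ≠ 0

namespace IsRandersOn

variable {U : Set Coord} {D : Set (Coord × Coord)} {f : Coord → Coord → ℝ}
  {a : Coord → Matrix (Fin 4) (Fin 4) ℝ} {b : Coord → Fin 4 → ℝ}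
  {Γ : Fin 4 → Coord → Matrix (Fin 4) (Fin 4) ℝ} {x y : Coord}
variable (hR : IsRandersOn U D f a b) (h : (x, y) ∈ D)
include hR

theorem smoothOn : SmoothOn D f := by
  have hay (i : Fin 4) : SmoothOn D fun x y => (a x *ᵥ y) i :=
    ContDiffOn.sum (s := Finset.univ) fun j _ =>
      (SmoothOn.of_base (hR.isMetricOn.contDiffOn i j) fun p hp => hR.fst_mem p.1 p.2 hp).mul
        (SmoothOn.fiberCoord j)
  have hq : SmoothOn D fun x y => y ⬝ᵥ a x *ᵥ y :=
    ContDiffOn.sum fun i _ => (SmoothOn.fiberCoord i).mul (hay i)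
  have hb : SmoothOn D fun x y => b x ⬝ᵥ y :=
    ContDiffOn.sum fun i _ =>
      (SmoothOn.of_base (hR.contDiffOn_form i) fun p hp => hR.fst_mem p.1 p.2 hp).mul
        (SmoothOn.fiberCoord i)
  exact ((ContDiffOn.sqrt hq fun p hp => (hR.quadratic_pos p.1 p.2 hp).ne').add hb).congr
    fun p hp => hR.eq_randers p.1 p.2 hp

theorem nhds_right (h : (x, y) ∈ D) : ∀ᶠ z in nhds y, (x, z) ∈ D :=
  (hR.isOpen.preimage (Continuous.prodMk_right x)).mem_nhds h

include h

theorem vertGrad_eq : vertGrad f x y = a x *ᵥ unitVec (a x) y + b x := by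
  ext k
  have hpos := hR.quadratic_pos x y h
  have hq : DifferentiableAt ℝ (fun z : Coord => ⇑z ⬝ᵥ a x *ᵥ z) y :=
    (contDiff_quadratic (k := 1) (a x)).differentiable (by simp) y
  have hb : DifferentiableAt ℝ (fun z : Coord => b x ⬝ᵥ ⇑z) y :=
    (contDiff_dotProduct (k := 1) (b x)).differentiable (by simp) y
  have hlin : pd k (fun z : Coord => b x ⬝ᵥ ⇑z) y = b x k :=
    pd_mulVec_coord (Matrix.of fun _ : Unit => b x) () k
  refine (dy_congr hR.isOpen hR.eq_randers h k).trans <|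
    (pd_add (hq.sqrt hpos.ne') hb k).trans ?_
  rw [pd_sqrt_quadratic (hR.isMetricOn.isSymm x (hR.fst_mem x y h)) hpos, hlin, Pi.add_apply]

theorem dx_eq (i : Fin 4) :
    dx i f x y = (y ⬝ᵥ pdMatrix i a x *ᵥ y) / (2 * √(y ⬝ᵥ a x *ᵥ y)) + pdVec i b x ⬝ᵥ y := by
  have hx := hR.fst_mem x y h
  have ha (i j : Fin 4) := (hR.isMetricOn.contDiffAt hx i j).differentiableAt (by simp)
  have hb (i : Fin 4) : DifferentiableAt ℝ (fun z => b z i) x :=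
    ((hR.contDiffOn_form i).contDiffAt (hR.isMetricOn.isOpen.mem_nhds hx)).differentiableAt
      (by simp)
  have hpos := hR.quadratic_pos x y h
  have hy (i : Fin 4) : DifferentiableAt ℝ (fun _ : Coord => y i) x := differentiableAt_const _
  have hconst : pdVec i (fun _ : Coord => ⇑y) x = 0 := funext fun j => pd_const (y j) i
  have hay (i : Fin 4) : DifferentiableAt ℝ (fun z => (a z *ᵥ y) i) x := by
    simp only [Matrix.mulVec, dotProduct]
    exact .fun_sum fun j _ => (ha i j).mul (hy j)
  have hq : DifferentiableAt ℝ (fun z => ⇑y ⬝ᵥ a z *ᵥ y) x :=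
    .fun_sum fun j _ => (hy j).mul (hay j)
  have hby : DifferentiableAt ℝ (fun z => b z ⬝ᵥ ⇑y) x :=
    .fun_sum fun j _ => (hb j).mul (hy j)
  refine (dx_congr hR.isOpen hR.eq_randers h i).trans <|
    (pd_add (hq.sqrt hpos.ne') hby i).trans ?_
  rw [pd_sqrt hq hpos.ne', pd_dotProduct hy hay, pd_dotProduct hb hy, pdVec_mulVec ha hy, hconst]
  simp only [zero_dotProduct, dotProduct_zero, Matrix.mulVec_zero, add_zero, zero_add]

omit h in
theorem isFinslerOn : IsFinslerOn D f where
  isOpen := hR.isOpen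
  smoothOn := hR.smoothOn
  euler x y h := by
    rw [hR.vertGrad_eq h, hR.eq_randers x y h, randers, unitVec, dotProduct_add,
      Matrix.mulVec_smul, dotProduct_smul, smul_eq_mul, inv_mul_eq_div, Real.div_sqrt,
      dotProduct_comm (b x)]
  det_ne_zero := hR.det_ne_zero

theorem dx_sub_dotProduct_vertGrad (i : Fin 4) :
    dx i f x y - (Γ i x *ᵥ y) ⬝ᵥ vertGrad f x y =
      (y ⬝ᵥ covDerivMetric Γ a i x *ᵥ y) / (2 * √(y ⬝ᵥ a x *ᵥ y)) +
        covDerivForm Γ b i x ⬝ᵥ y := by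
  have hsymm := hR.isMetricOn.isSymm x (hR.fst_mem x y h)
  have hmetric : y ⬝ᵥ (a x * Γ i x + (Γ i x)ᵀ * a x) *ᵥ y =
      2 * ((Γ i x *ᵥ y) ⬝ᵥ a x *ᵥ y) := by
    rw [Matrix.add_mulVec, dotProduct_add, ← Matrix.mulVec_mulVec, ← Matrix.mulVec_mulVec,
      Matrix.dotProduct_mulVec y (a x), ← Matrix.mulVec_transpose, hsymm,
      Matrix.dotProduct_mulVec y (Γ i x)ᵀ, Matrix.vecMul_transpose, dotProduct_comm, two_mul]
  have hform : ((Γ i x)ᵀ *ᵥ b x) ⬝ᵥ y = (Γ i x *ᵥ y) ⬝ᵥ b x := by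
    rw [Matrix.mulVec_transpose, ← Matrix.dotProduct_mulVec, dotProduct_comm]
  rw [hR.dx_eq h, hR.vertGrad_eq h, covDerivMetric, covDerivForm, Matrix.sub_mulVec,
    dotProduct_sub, hmetric, sub_dotProduct, hform, dotProduct_add, unitVec, Matrix.mulVec_smul,
    dotProduct_smul, smul_eq_mul]
  ring

theorem covDeriv_eq_zero_of_isBerwaldOn (hB : IsBerwaldOn D f Γ) (i : Fin 4) :
    covDerivMetric Γ a i x = 0 ∧ covDerivForm Γ b i x = 0 := by
  have hx := hR.fst_mem x y h
  have ha := hR.isMetricOn.isSymm x hx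
  have hzero := eq_zero_of_sqrt_quadratic_mul_eq ha (hR.isMetricOn.det_ne_zero x hx)
    (p₁ := fun z => 2 * (covDerivForm Γ b i x ⬝ᵥ ⇑z))
    (p₂ := fun z => -(⇑z ⬝ᵥ covDerivMetric Γ a i x *ᵥ z)) (ε := -1) (z := y)
    (contDiff_const.mul (contDiff_dotProduct _)) (contDiff_quadratic _).neg (by norm_num)
    (fun z => by simp) (fun z => by simp [Matrix.mulVec_neg]) (by
      filter_upwards [hR.nhds_right h] with z hz
      have hpos := hR.quadratic_pos x z hz
      have hdx := hR.dx_sub_dotProduct_vertGrad (Γ := Γ) hz i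
      rw [hB.dx_eq hR.isFinslerOn hz, sub_self] at hdx
      have hα := (Real.sqrt_pos.2 hpos).ne'
      refine ⟨hpos, ?_⟩
      field_simp at hdx
      linear_combination -hdx)
  constructor
  · refine eq_zero_of_isSymm_of_quadratic_eq_zero ?_ fun v =>
      neg_eq_zero.1 (congrFun hzero.2 (WithLp.toLp 2 v))
    rw [covDerivMetric]
    refine (hR.isMetricOn.pdMatrix_isSymm hx i).sub ?_
    rw [Matrix.IsSymm, Matrix.transpose_add, Matrix.transpose_mul, Matrix.transpose_mul,
      Matrix.transpose_transpose, ha, add_comm]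
  · exact dotProduct_eq_zero _ fun v =>
      (mul_eq_zero.1 (congrFun hzero.1 (WithLp.toLp 2 v))).resolve_left two_ne_zero

omit h in
theorem isBerwaldOn_christoffelMatrix (hB : IsBerwaldOn D f Γ) :
    IsBerwaldOn D f (christoffelMatrix a) := by
  intro x y h i j
  rw [hB x y h, hR.isMetricOn.eq_christoffelMatrix (hR.fst_mem x y h)
    (hB.isTorsionFreeAt hR.isFinslerOn h) fun k => (hR.covDeriv_eq_zero_of_isBerwaldOn h hB k).1]

omit h in
theorem isBerwaldOn_christoffelMatrix_iff : IsBerwaldOn D f (christoffelMatrix a) ↔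
    ∀ x ∈ U, ∀ i, covDerivForm (christoffelMatrix a) b i x = 0 := by
  constructor
  · intro hB x hx i
    obtain ⟨y, h⟩ := hR.exists_mem x hx
    exact (hR.covDeriv_eq_zero_of_isBerwaldOn h hB i).2
  · intro hb
    refine isBerwaldOn_of_dx_eq hR.isFinslerOn (fun x y h i => ?_) fun x y h =>
      hR.isMetricOn.christoffelMatrix_isTorsionFreeAt (hR.fst_mem x y h)
    have hx := hR.fst_mem x y h
    rw [← sub_eq_zero, hR.dx_sub_dotProduct_vertGrad h, hb x hx,
      hR.isMetricOn.covDerivMetric_christoffelMatrix hx]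
    simp

end IsRandersOn

/-! ### The field equation for Randers metrics of Berwald type -/

section LinearAlgebra

variable {n K : Type*} [Fintype n] [Field K]

theorem sum_mul_eq_trace_mul {A B : Matrix n n K} (hB : B.IsSymm) :
    ∑ i, ∑ j, A i j * B i j = (A * B).trace := by
  simp only [Matrix.trace, Matrix.diag_apply, Matrix.mul_apply, hB.apply]

theorem trace_vecMulVec_mul (v w : n → K) (A : Matrix n n K) :
    (Matrix.vecMulVec v w * A).trace = w ⬝ᵥ A *ᵥ v := by
  rw [Matrix.vecMulVec_mul, Matrix.trace_vecMulVec, dotProduct_comm, Matrix.dotProduct_mulVec]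

theorem eq_zero_of_smul_eq_trace_smul [DecidableEq n] {A R : Matrix n n K} (hA : IsUnit A.det)
    {c : K} (hc : c ≠ 0) (hcard : c ≠ Fintype.card n)
    (h : c • R = (A⁻¹ * R).trace • A) : R = 0 := by
  have htrace : c * (A⁻¹ * R).trace = (A⁻¹ * R).trace * Fintype.card n := by
    have := congrArg (fun X => (A⁻¹ * X).trace) h
    simpa only [Matrix.mul_smul, Matrix.trace_smul, smul_eq_mul, Matrix.nonsing_inv_mul _ hA,
      Matrix.trace_one] using this
  have hzero : (A⁻¹ * R).trace = 0 := by
    have : (c - Fintype.card n) * (A⁻¹ * R).trace = 0 := by linear_combination htrace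
    exact (mul_eq_zero.1 this).resolve_left (sub_ne_zero.2 hcard)
  rw [hzero, zero_smul] at h
  exact (smul_eq_zero.1 h).resolve_left hc

open Matrix in
/-- With `v = y / α`, `s = F / α` and `c` the vector dual to the one-form, the matrix on the left
is the fundamental tensor of a Randers metric. -/
theorem inv_smul_sub_vecMulVec_add_vecMulVec [DecidableEq n] {A : Matrix n n K} (hA : A.IsSymm)
    (hdet : IsUnit A.det) {v c : n → K} {s : K} (hs : s ≠ 0) (hv : v ⬝ᵥ A *ᵥ v = 1)
    (hc : v ⬝ᵥ A *ᵥ c = s - 1) :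
    (s • (A - vecMulVec (A *ᵥ v) (A *ᵥ v)) +
        vecMulVec (A *ᵥ v + A *ᵥ c) (A *ᵥ v + A *ᵥ c))⁻¹ =
      s⁻¹ • A⁻¹ + ((c ⬝ᵥ A *ᵥ c + s - 1) / s ^ 3) • vecMulVec v v -
        (s ^ 2)⁻¹ • (vecMulVec v c + vecMulVec c v) := by
  refine Matrix.inv_eq_right_inv ?_
  have hinv (w : n → K) : (A *ᵥ w) ᵥ* A⁻¹ = w := by
    rw [← vecMul_transpose, hA, vecMul_vecMul, mul_nonsing_inv _ hdet, vecMul_one]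
  have hvv : A *ᵥ v ⬝ᵥ v = 1 := by rw [dotProduct_comm, hv]
  have hcv : A *ᵥ c ⬝ᵥ v = s - 1 := by rw [dotProduct_comm, hc]
  have hvc : A *ᵥ v ⬝ᵥ c = s - 1 := by
    rw [← hc, dotProduct_mulVec, ← mulVec_transpose, hA]
  have hcc : A *ᵥ c ⬝ᵥ c = c ⬝ᵥ A *ᵥ c := dotProduct_comm _ _
  simp only [add_mul, mul_add, mul_sub, sub_mul, smul_mul_assoc, mul_smul_comm, smul_sub, smul_add,
    mul_nonsing_inv _ hdet, mul_vecMulVec, vecMulVec_mul, vecMulVec_mulVec, hinv,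
    add_vecMulVec, vecMulVec_add, hvv, hvc, hcv, hcc]
  ext i j
  simp only [Matrix.add_apply, Matrix.sub_apply, Matrix.smul_apply, vecMulVec_apply, smul_eq_mul,
    Pi.smul_apply, MulOpposite.smul_eq_mul_unop, MulOpposite.unop_op]
  field_simp
  ring

end LinearAlgebra

theorem smul_eq_smul_of_field_equation {n : Type*} [Fintype n] {A R : Matrix n n ℝ}
    (hA : A.IsSymm) (hR : R.IsSymm) {b c : n → ℝ} {t : ℝ}
    (h₁ : ∀ y, (y ⬝ᵥ A *ᵥ y + (b ⬝ᵥ y) ^ 2) * t + (b ⬝ᵥ c - 3) * (y ⬝ᵥ R *ᵥ y) = 0)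
    (h₂ : ∀ y, -2 * (b ⬝ᵥ y) * (y ⬝ᵥ A *ᵥ y * t - y ⬝ᵥ R *ᵥ y) = 0) :
    (3 : ℝ) • R = t • A ∨ (1 : ℝ) • R = t • A := by
  have hsub (k : ℝ) (h : ∀ y, k * (y ⬝ᵥ R *ᵥ y) = t * (y ⬝ᵥ A *ᵥ y)) : k • R = t • A := by
    refine sub_eq_zero.1 (eq_zero_of_isSymm_of_quadratic_eq_zero ((hR.smul k).sub (hA.smul t))
      fun y => ?_)
    rw [Matrix.sub_mulVec, Matrix.smul_mulVec, Matrix.smul_mulVec, dotProduct_sub,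
      dotProduct_smul, dotProduct_smul, smul_eq_mul, smul_eq_mul, h, sub_self]
  by_cases hb : b = 0
  · refine .inl (hsub 3 fun y => ?_)
    have := h₁ y
    simp only [hb, zero_dotProduct] at this
    linear_combination -this
  · obtain ⟨v, hv⟩ : ∃ v, b ⬝ᵥ v ≠ 0 := by
      contrapose! hb
      exact dotProduct_eq_zero b hb
    have hlin : Continuous fun y : EuclideanSpace ℝ n => b ⬝ᵥ ⇑y :=
      (contDiff_dotProduct (k := 0) b).continuous
    have hzero := eq_zero_of_eventually_eq_zero (z := WithLp.toLp 2 v)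
      (((contDiff_quadratic A).mul contDiff_const).sub (contDiff_quadratic R)) <| by
        filter_upwards [hlin.continuousAt.eventually_ne hv] with y hy
        exact (mul_eq_zero.1 (h₂ y)).resolve_left (mul_ne_zero (by norm_num) hy)
    refine .inr (hsub 1 fun y => ?_)
    have : y ⬝ᵥ A *ᵥ y * t - y ⬝ᵥ R *ᵥ y = 0 := congrFun hzero (WithLp.toLp 2 y)
    linear_combination -this

namespace IsRandersOn

variable {U : Set Coord} {D : Set (Coord × Coord)} {f : Coord → Coord → ℝ}
  {a : Coord → Matrix (Fin 4) (Fin 4) ℝ} {b : Coord → Fin 4 → ℝ} {x y : Coord}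
variable (hR : IsRandersOn U D f a b)
include hR

open Matrix in
theorem fundamentalTensor_eq (h : (x, y) ∈ D) : fundamentalTensor f x y =
    (f x y / √(y ⬝ᵥ a x *ᵥ y)) •
        (a x - vecMulVec (a x *ᵥ unitVec (a x) y) (a x *ᵥ unitVec (a x) y)) +
      vecMulVec (a x *ᵥ unitVec (a x) y + b x) (a x *ᵥ unitVec (a x) y + b x) := by
  have hsymm := hR.isMetricOn.isSymm x (hR.fst_mem x y h)
  have hpos := hR.quadratic_pos x y h
  have hα := (Real.sqrt_pos.2 hpos).ne'
  have hsqrt : DifferentiableAt ℝ (fun z : Coord => √(z ⬝ᵥ a x *ᵥ z)) y :=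
    ((contDiff_quadratic (k := 1) (a x)).differentiable (by simp) y).sqrt hpos.ne'
  have hgrad (z : Coord) (hz : (x, z) ∈ D) (j : Fin 4) :
      dy j f x z = (a x *ᵥ unitVec (a x) z + b x) j := congrFun (hR.vertGrad_eq hz) j
  ext i j
  have hdy : DifferentiableAt ℝ (dy j f x) y :=
    (hR.smoothOn.smoothOn_dy hR.isOpen j).differentiableAt_right hR.isOpen h
  have hmul : ∀ᶠ z : Coord in nhds y,
      √(z ⬝ᵥ a x *ᵥ z) * dy j f x z = (a x *ᵥ z) j + b x j * √(z ⬝ᵥ a x *ᵥ z) := by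
    filter_upwards [hR.nhds_right h] with z hz
    have hα := (Real.sqrt_pos.2 (hR.quadratic_pos x z hz)).ne'
    rw [hgrad z hz, unitVec, mulVec_smul, Pi.add_apply, Pi.smul_apply, smul_eq_mul]
    field_simp
  have hhess := pd_congr hmul i
  rw [pd_mul hsqrt hdy, pd_add (differentiableAt_mulVec_coord _ _) (hsqrt.const_mul _),
    pd_const_mul _ hsqrt, pd_mulVec_coord, pd_sqrt_quadratic hsymm hpos, hgrad y h,
    hsymm.apply, Pi.add_apply] at hhess
  have hdy_dy : pd i (dy j f x) y = (a x i j - (a x *ᵥ unitVec (a x) y) i *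
      (a x *ᵥ unitVec (a x) y) j) / √(y ⬝ᵥ a x *ᵥ y) :=
    eq_div_of_mul_eq hα (by linear_combination hhess)
  rw [hR.isFinslerOn.fundamentalTensor_apply h, hgrad y h, hgrad y h, dy, ← pd, hdy_dy,
    Matrix.add_apply, Matrix.smul_apply, Matrix.sub_apply, vecMulVec_apply, vecMulVec_apply,
    smul_eq_mul]
  ring

/-- Since `R` annihilates the dual of `b`, only the first two terms of the inverse of the
fundamental tensor contribute. -/
theorem trace_inv_fundamentalTensor_mul (h : (x, y) ∈ D) {R : Matrix (Fin 4) (Fin 4) ℝ}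
    (hsymm : R.IsSymm) (hdual : R *ᵥ ((a x)⁻¹ *ᵥ b x) = 0) :
    f x y ^ 3 * ((fundamentalTensor f x y)⁻¹ * R).trace =
      √(y ⬝ᵥ a x *ᵥ y) * f x y ^ 2 * ((a x)⁻¹ * R).trace +
        (√(y ⬝ᵥ a x *ᵥ y) * (b x ⬝ᵥ (a x)⁻¹ *ᵥ b x) + b x ⬝ᵥ y) * (y ⬝ᵥ R *ᵥ y) := by
  have hx := hR.fst_mem x y h
  have hpos := hR.quadratic_pos x y h
  have hα := (Real.sqrt_pos.2 hpos).ne'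
  have hf := hR.isFinslerOn.ne_zero h
  set c := (a x)⁻¹ *ᵥ b x with hc
  have hac : a x *ᵥ c = b x := by
    rw [hc, Matrix.mulVec_mulVec, Matrix.mul_nonsing_inv _ (hR.isMetricOn.isUnit_det hx),
      Matrix.one_mulVec]
  have hvb : unitVec (a x) y ⬝ᵥ b x = f x y / √(y ⬝ᵥ a x *ᵥ y) - 1 := by
    rw [unitVec, smul_dotProduct, smul_eq_mul, hR.eq_randers x y h, randers,
      dotProduct_comm _ (b x)]
    field_simp
    ring
  have hinv := inv_smul_sub_vecMulVec_add_vecMulVec (hR.isMetricOn.isSymm x hx)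
    (hR.isMetricOn.isUnit_det hx) (div_ne_zero hf hα) (unitVec_dotProduct_mulVec hpos)
    (c := c) (by rw [hac, hvb])
  have hcv : c ⬝ᵥ R *ᵥ unitVec (a x) y = 0 := by
    rw [Matrix.dotProduct_mulVec, ← Matrix.mulVec_transpose, hsymm, hdual, zero_dotProduct]
  have hvv : unitVec (a x) y ⬝ᵥ R *ᵥ unitVec (a x) y = (y ⬝ᵥ R *ᵥ y) / √(y ⬝ᵥ a x *ᵥ y) ^ 2 := by
    rw [unitVec, Matrix.mulVec_smul, smul_dotProduct, dotProduct_smul, smul_eq_mul,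
      smul_eq_mul]
    ring
  rw [hR.fundamentalTensor_eq h, ← hac, hinv]
  simp only [sub_mul, add_mul, smul_mul_assoc, Matrix.trace_add, Matrix.trace_sub,
    Matrix.trace_smul, trace_vecMulVec_mul, smul_eq_mul, hdual, hac, hcv, hvv, dotProduct_zero]
  rw [hR.eq_randers x y h, randers] at hf ⊢
  rw [dotProduct_comm c]
  field_simp
  ring

theorem sqrt_mul_eq_of_trace_inv_fundamentalTensor_mul_eq (h : (x, y) ∈ D)
    {R : Matrix (Fin 4) (Fin 4) ℝ} (hsymm : R.IsSymm) (hdual : R *ᵥ ((a x)⁻¹ *ᵥ b x) = 0)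
    (htrace : ((fundamentalTensor f x y)⁻¹ * R).trace = 3 / f x y ^ 2 * (y ⬝ᵥ R *ᵥ y)) :
    √(y ⬝ᵥ a x *ᵥ y) * ((y ⬝ᵥ a x *ᵥ y + (b x ⬝ᵥ y) ^ 2) * ((a x)⁻¹ * R).trace +
        (b x ⬝ᵥ (a x)⁻¹ *ᵥ b x - 3) * (y ⬝ᵥ R *ᵥ y)) =
      -2 * (b x ⬝ᵥ y) * (y ⬝ᵥ a x *ᵥ y * ((a x)⁻¹ * R).trace - y ⬝ᵥ R *ᵥ y) := by
  have hf := hR.isFinslerOn.ne_zero h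
  have hsq := Real.sq_sqrt (hR.quadratic_pos x y h).le
  have hcube : f x y ^ 3 * (3 / f x y ^ 2 * (y ⬝ᵥ R *ᵥ y)) = 3 * f x y * (y ⬝ᵥ R *ᵥ y) := by
    field_simp
  have hpoly := hR.trace_inv_fundamentalTensor_mul h hsymm hdual
  rw [htrace, hcube, hR.eq_randers x y h, randers] at hpoly
  linear_combination -hpoly -
    (√(y ⬝ᵥ a x *ᵥ y) + 2 * (b x ⬝ᵥ y)) * ((a x)⁻¹ * R).trace * hsq

theorem eq_zero_of_trace_inv_fundamentalTensor_mul_eq (hx : x ∈ U)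
    {R : Matrix (Fin 4) (Fin 4) ℝ} (hsymm : R.IsSymm) (hdual : R *ᵥ ((a x)⁻¹ *ᵥ b x) = 0)
    (htrace : ∀ y : Coord, (x, y) ∈ D →
      ((fundamentalTensor f x y)⁻¹ * R).trace = 3 / f x y ^ 2 * (y ⬝ᵥ R *ᵥ y)) : R = 0 := by
  obtain ⟨y, h⟩ := hR.exists_mem x hx
  have ha := hR.isMetricOn.isSymm x hx
  obtain ⟨h₁, h₂⟩ := eq_zero_of_sqrt_quadratic_mul_eq ha (hR.isMetricOn.det_ne_zero x hx)
    (p₁ := fun z => (⇑z ⬝ᵥ a x *ᵥ z + (b x ⬝ᵥ ⇑z) ^ 2) * ((a x)⁻¹ * R).trace +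
      (b x ⬝ᵥ (a x)⁻¹ *ᵥ b x - 3) * (⇑z ⬝ᵥ R *ᵥ z))
    (p₂ := fun z => -2 * (b x ⬝ᵥ ⇑z) *
      (⇑z ⬝ᵥ a x *ᵥ z * ((a x)⁻¹ * R).trace - ⇑z ⬝ᵥ R *ᵥ z))
    (ε := 1) (z := y)
    ((((contDiff_quadratic _).add ((contDiff_dotProduct _).pow 2)).mul contDiff_const).add
      (contDiff_const.mul (contDiff_quadratic _)))
    ((contDiff_const.mul (contDiff_dotProduct _)).mul
      (((contDiff_quadratic _).mul contDiff_const).sub (contDiff_quadratic _)))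
    one_ne_zero (fun z => by simp [Matrix.mulVec_neg]) (fun z => by simp [Matrix.mulVec_neg]) <| by
      filter_upwards [hR.nhds_right h] with z hz using ⟨hR.quadratic_pos x z hz,
        hR.sqrt_mul_eq_of_trace_inv_fundamentalTensor_mul_eq hz hsymm hdual (htrace z hz)⟩
  have hdet := hR.isMetricOn.isUnit_det hx
  rcases smul_eq_smul_of_field_equation ha hsymm
    (fun v => congrFun h₁ (WithLp.toLp 2 v)) (fun v => congrFun h₂ (WithLp.toLp 2 v)) with h | h
  · exact eq_zero_of_smul_eq_trace_smul hdet three_ne_zero (by norm_num) h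
  · exact eq_zero_of_smul_eq_trace_smul hdet one_ne_zero (by norm_num) h

theorem field_equation_iff_ricciMatrix_eq_zero (hB : IsBerwaldOn D f (christoffelMatrix a))
    (hx : x ∈ U) :
    (∀ y : Coord, (x, y) ∈ D → ∑ i, ∑ j, ((fundamentalTensor f x y)⁻¹ i j -
      3 / f x y ^ 2 * (y i * y j)) * finslerRicciTensor f i j x y = 0) ↔
      ricciMatrix a x = 0 := by
  have hsymm := hR.isMetricOn.ricciMatrix_isSymm hx
  have hsum (y : Coord) (h : (x, y) ∈ D) : ∑ i, ∑ j, ((fundamentalTensor f x y)⁻¹ i j -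
      3 / f x y ^ 2 * (y i * y j)) * finslerRicciTensor f i j x y =
      ((fundamentalTensor f x y)⁻¹ * ricciMatrix a x).trace -
        3 / f x y ^ 2 * (y ⬝ᵥ ricciMatrix a x *ᵥ y) := by
    simp only [finslerRicciTensor_eq_ricciMatrix hR.isMetricOn hR.isOpen hR.fst_mem hB h,
      ← trace_vecMulVec_mul, ← sum_mul_eq_trace_mul hsymm, sub_mul, Finset.sum_sub_distrib,
      Finset.mul_sum, Matrix.vecMulVec_apply, mul_assoc]
  constructor
  · intro hv
    exact hR.eq_zero_of_trace_inv_fundamentalTensor_mul_eq hx hsymm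
      (hR.isMetricOn.ricciMatrix_mulVec_dual_eq_zero hx hR.contDiffOn_form
        (hR.isBerwaldOn_christoffelMatrix_iff.1 hB)) fun y h =>
        sub_eq_zero.1 ((hsum y h).symm.trans (hv y h))
  · intro hric y h
    rw [hsum y h, hric]
    simp

end IsRandersOn

theorem IsLorentzian.det_ne_zero {g : Matrix (Fin 4) (Fin 4) ℝ} (hg : IsLorentzian g) :
    g.det ≠ 0 := by
  obtain ⟨P, -, h⟩ := hg
  intro hdet
  have hzero : (Pᵀ * g * P).det = 0 := by
    rw [Matrix.det_mul, Matrix.det_mul, hdet, mul_zero, zero_mul]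
  rcases h with h | h <;> rw [h] at hzero <;> simp [Fin.prod_univ_four] at hzero

/-! ### Charts -/

section Linear

variable {ι V : Type*} [Fintype ι] [DecidableEq ι] [TopologicalSpace V] [AddCommGroup V]
  [Module ℝ V]

theorem apply_eq_sum_smul_single (T : EuclideanSpace ℝ ι →L[ℝ] V) (y : EuclideanSpace ℝ ι) :
    T y = ∑ i, y i • T (EuclideanSpace.single i 1) := by
  conv_lhs => rw [← (EuclideanSpace.basisFun ι ℝ).sum_repr y]
  simp only [EuclideanSpace.basisFun_repr, EuclideanSpace.basisFun_apply, map_sum, map_smul]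

theorem form_apply_eq_dotProduct (B : V →L[ℝ] ℝ) (T : EuclideanSpace ℝ ι →L[ℝ] V)
    (y : EuclideanSpace ℝ ι) :
    B (T y) = (fun i => B (T (EuclideanSpace.single i 1))) ⬝ᵥ ⇑y := by
  rw [apply_eq_sum_smul_single T y]
  simp only [map_sum, map_smul, smul_eq_mul, dotProduct, mul_comm]

theorem form_apply_eq_dotProduct_mulVec (B : V →L[ℝ] V →L[ℝ] ℝ)
    (T : EuclideanSpace ℝ ι →L[ℝ] V) (y z : EuclideanSpace ℝ ι) :
    B (T y) (T z) = ⇑y ⬝ᵥ (Matrix.of fun i j =>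
      B (T (EuclideanSpace.single i 1)) (T (EuclideanSpace.single j 1))) *ᵥ ⇑z := by
  rw [apply_eq_sum_smul_single T y]
  simp only [map_sum, map_smul, _root_.sum_apply, _root_.smul_apply, smul_eq_mul,
    form_apply_eq_dotProduct (B (T _)) T z, dotProduct, Matrix.mulVec, Matrix.of_apply]

theorem det_ne_zero_of_nondegenerate {B : V →L[ℝ] V →L[ℝ] ℝ}
    (hB : ∀ v, (∀ w, B v w = 0) → v = 0) {T : EuclideanSpace ℝ ι →L[ℝ] V}
    (hT : Function.Bijective T) :
    (Matrix.of fun i j : ι =>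
      B (T (EuclideanSpace.single i 1)) (T (EuclideanSpace.single j 1))).det ≠ 0 := by
  intro hdet
  obtain ⟨v, hv, hv0⟩ := Matrix.exists_vecMul_eq_zero_iff.2 hdet
  have hTv : T (WithLp.toLp 2 v) = 0 := by
    refine hB _ fun w => ?_
    obtain ⟨z, rfl⟩ := hT.2 w
    rw [form_apply_eq_dotProduct_mulVec, Matrix.dotProduct_mulVec, hv0, zero_dotProduct]
  exact hv ((WithLp.toLp_eq_zero 2).1 (hT.1 (hTv.trans (map_zero T).symm)))

end Linear

section Charts

variable {M : Type*} [TopologicalSpace M] [ChartedSpace Coord M]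
  {e : OpenPartialHomeomorph M Coord} (he : e ∈ IsManifold.maximalAtlas (𝓡 4) ∞ M)
include he

theorem mfderiv_symm_bijective {x : Coord} (hx : x ∈ e.target) :
    Function.Bijective (mfderiv (𝓡 4) (𝓡 4) e.symm x) :=
  OpenPartialHomeomorph.MDifferentiable.mfderiv_bijective (e := e.symm)
    ⟨(contMDiffOn_symm_of_mem_maximalAtlas he).mdifferentiableOn (by simp),
      (contMDiffOn_of_mem_maximalAtlas he).mdifferentiableOn (by simp)⟩ hx

theorem PseudoRiemannianMetric.isMetricOn_components (a : PseudoRiemannianMetric M) :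
    IsMetricOn e.target (a.components e) where
  isOpen := e.open_target
  contDiffOn := a.smooth e he
  isSymm _ _ := Matrix.IsSymm.ext fun _ _ => a.symm _ _ _
  det_ne_zero _ hx :=
    det_ne_zero_of_nondegenerate (a.nondegenerate _) (mfderiv_symm_bijective he hx)

variable [IsManifold (𝓡 4) ∞ M]

theorem continuousOn_ofCoord :
    ContinuousOn (fun p : Coord × Coord => ofCoord e p.1 p.2) (e.target ×ˢ Set.univ) := by
  have htangent := (contMDiffOn_symm_of_mem_maximalAtlas he).continuousOn_tangentMapWithin
    (by simp) e.open_target.uniqueMDiffOn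
  have hcomp := htangent.comp
    (tangentBundleModelSpaceHomeomorph (𝓡 4)).symm.continuous.continuousOn
    (s := e.target ×ˢ (Set.univ : Set Coord)) (fun p hp => hp.1)
  refine hcomp.congr fun p hp => ?_
  rw [Function.comp_apply, tangentBundleModelSpaceHomeomorph_coe_symm]
  change _ = (⟨e.symm p.1, mfderivWithin (𝓡 4) (𝓡 4) e.symm e.target p.1 p.2⟩ :
    TangentBundle (𝓡 4) M)
  rw [mfderivWithin_of_isOpen e.open_target hp.1]
  rfl

theorem isOpen_setOf_ofCoord_mem {A : Set (TangentBundle (𝓡 4) M)} (hA : IsOpen A) :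
    IsOpen {p : Coord × Coord | p.1 ∈ e.target ∧ ofCoord e p.1 p.2 ∈ A} := by
  convert (continuousOn_ofCoord he).isOpen_inter_preimage (e.open_target.prod isOpen_univ) hA
    using 1
  ext p
  simp

theorem isRandersOn_inChart {A : Set (TangentBundle (𝓡 4) M)} {F : TangentBundle (𝓡 4) M → ℝ}
    {a : PseudoRiemannianMetric M} {b : OneForm M} (hA : IsOpen A)
    (hfiber : ∀ p : M, ∃ v : TangentSpace (𝓡 4) p, (⟨p, v⟩ : TangentBundle (𝓡 4) M) ∈ A)
    (hR : IsRanders A F a b)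
    (hdet : ∀ x ∈ e.target, ∀ y : Coord, ofCoord e x y ∈ A →
      (fundamentalTensor (inChart e F) x y).det ≠ 0) :
    IsRandersOn e.target {p | p.1 ∈ e.target ∧ ofCoord e p.1 p.2 ∈ A} (inChart e F)
      (a.components e) (fun x i => b.components e i x) := by
  have hquad (x y : Coord) : a.form (e.symm x) (mfderiv (𝓡 4) (𝓡 4) e.symm x y)
      (mfderiv (𝓡 4) (𝓡 4) e.symm x y) = ⇑y ⬝ᵥ a.components e x *ᵥ ⇑y :=
    form_apply_eq_dotProduct_mulVec (a.form (e.symm x)) (mfderiv (𝓡 4) (𝓡 4) e.symm x) y y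
  have hlin (x y : Coord) : b.form (e.symm x) (mfderiv (𝓡 4) (𝓡 4) e.symm x y) =
      (fun i => b.components e i x) ⬝ᵥ ⇑y :=
    form_apply_eq_dotProduct (b.form (e.symm x)) (mfderiv (𝓡 4) (𝓡 4) e.symm x) y
  exact
  { isMetricOn := a.isMetricOn_components he
    contDiffOn_form := b.smooth e he
    isOpen := isOpen_setOf_ofCoord_mem he hA
    fst_mem := fun _ _ h => h.1
    exists_mem := fun x hx => by
      obtain ⟨v, hv⟩ := hfiber (e.symm x)
      obtain ⟨y, rfl⟩ := (mfderiv_symm_bijective he hx).2 v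
      exact ⟨y, hx, hv⟩
    quadratic_pos := fun x y h => (hR _ _ h.2).1.trans_eq (hquad x y)
    eq_randers := fun x y h =>
      (hR _ _ h.2).2.trans (congrArg₂ (fun s t => √s + t) (hquad x y) (hlin x y))
    det_ne_zero := fun x y h => hdet x h.1 y h.2 }

end Charts

section Global

variable {M : Type*} [TopologicalSpace M] [ChartedSpace Coord M]
  {A : Set (TangentBundle (𝓡 4) M)} {F : TangentBundle (𝓡 4) M → ℝ}
  {a : PseudoRiemannianMetric M} {b : OneForm M}

theorem isBerwald_iff :
    IsBerwald A F ↔ ∀ e ∈ IsManifold.maximalAtlas (𝓡 4) ∞ M, ∃ Γ,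
      IsBerwaldOn {p | p.1 ∈ e.target ∧ ofCoord e p.1 p.2 ∈ A} (inChart e F) Γ := by
  refine forall₂_congr fun e _ => ⟨fun ⟨Γ, h⟩ => ?_, fun ⟨Γ, h⟩ => ?_⟩
  · exact ⟨fun j x => Matrix.of fun i k => Γ i j k x, fun x y hxy => h x hxy.1 y hxy.2⟩
  · exact ⟨fun i j k x => Γ j x i k, fun x hx y hxy => h x y ⟨hx, hxy⟩⟩

theorem isParallel_iff :
    IsParallel a b ↔ ∀ e ∈ IsManifold.maximalAtlas (𝓡 4) ∞ M, ∀ x ∈ e.target, ∀ i,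
      covDerivForm (christoffelMatrix (a.components e)) (fun x i => b.components e i x) i x = 0 :=
  forall₅_congr fun _ _ _ _ _ => funext_iff.symm

theorem solvesEinsteinVacuum_iff :
    SolvesEinsteinVacuum a ↔ ∀ e ∈ IsManifold.maximalAtlas (𝓡 4) ∞ M, ∀ x ∈ e.target,
      ricciMatrix (a.components e) x = 0 :=
  forall₄_congr fun _ _ _ _ => Matrix.ext_iff

variable [IsManifold (𝓡 4) ∞ M] (hA : IsOpen A)
  (hfiber : ∀ p : M, ∃ v : TangentSpace (𝓡 4) p, (⟨p, v⟩ : TangentBundle (𝓡 4) M) ∈ A)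
  (hR : IsRanders A F a b)
  (hdet : ∀ e ∈ IsManifold.maximalAtlas (𝓡 4) ∞ M, ∀ x ∈ e.target, ∀ y : Coord,
    ofCoord e x y ∈ A → (fundamentalTensor (inChart e F) x y).det ≠ 0)
include hA hfiber hR hdet

theorem isBerwald_iff_isParallel : IsBerwald A F ↔ IsParallel a b := by
  rw [isBerwald_iff, isParallel_iff]
  refine forall₂_congr fun e he => ?_
  have hchart := isRandersOn_inChart he hA hfiber hR (hdet e he)
  rw [← hchart.isBerwaldOn_christoffelMatrix_iff]
  exact ⟨fun ⟨_, hB⟩ => hchart.isBerwaldOn_christoffelMatrix hB, fun hB => ⟨_, hB⟩⟩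

theorem solvesFinslerVacuum_iff_solvesEinsteinVacuum (hB : IsBerwald A F) :
    SolvesFinslerVacuum A F ↔ SolvesEinsteinVacuum a := by
  rw [solvesEinsteinVacuum_iff]
  refine forall₄_congr fun e he x hx => ?_
  have hchart := isRandersOn_inChart he hA hfiber hR (hdet e he)
  obtain ⟨Γ, hΓ⟩ := isBerwald_iff.1 hB e he
  rw [← hchart.field_equation_iff_ricciMatrix_eq_zero
    (hchart.isBerwaldOn_christoffelMatrix hΓ) hx]
  exact forall_congr' fun y => ⟨fun h hy => h hy.2, fun h hy => h ⟨hx, hy⟩⟩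

end Global

end RandersSpacetime

theorem mainTheorem4_general {M : Type*} [TopologicalSpace M]
    [ChartedSpace RandersSpacetime.Coord M] [IsManifold (𝓡 4) ∞ M]
    (A : Set (TangentBundle (𝓡 4) M)) (F : TangentBundle (𝓡 4) M → ℝ)
    (a : RandersSpacetime.PseudoRiemannianMetric M) (b : RandersSpacetime.OneForm M)
    (hA : IsOpen A)
    (hfiber : ∀ p : M, ∃ v : TangentSpace (𝓡 4) p, (⟨p, v⟩ : TangentBundle (𝓡 4) M) ∈ A)
    (hR : RandersSpacetime.IsRanders A F a b)
    (hdet : ∀ e ∈ IsManifold.maximalAtlas (𝓡 4) ∞ M, ∀ x ∈ e.target,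
      ∀ y : RandersSpacetime.Coord, RandersSpacetime.ofCoord e x y ∈ A →
        (RandersSpacetime.fundamentalTensor (RandersSpacetime.inChart e F) x y).det ≠ 0) :
    List.TFAE [
      RandersSpacetime.IsBerwald A F ∧ RandersSpacetime.SolvesFinslerVacuum A F,
      RandersSpacetime.SolvesEinsteinVacuum a ∧ RandersSpacetime.IsBerwald A F,
      RandersSpacetime.SolvesEinsteinVacuum a ∧ RandersSpacetime.IsParallel a b] := by
  have hparallel := RandersSpacetime.isBerwald_iff_isParallel hA hfiber hR hdet
  tfae_have 1 ↔ 2 := by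
    rw [and_comm (b := RandersSpacetime.IsBerwald A F)]
    exact and_congr_right
      (RandersSpacetime.solvesFinslerVacuum_iff_solvesEinsteinVacuum hA hfiber hR hdet)
  tfae_have 2 ↔ 3 := and_congr_right' hparallel
  tfae_finish

theorem mainTheorem4 {M : Type*} [TopologicalSpace M] [ChartedSpace RandersSpacetime.Coord M]
    [IsManifold (𝓡 4) ∞ M] (A : Set (TangentBundle (𝓡 4) M)) (F : TangentBundle (𝓡 4) M → ℝ)
    (a : RandersSpacetime.PseudoRiemannianMetric M) (b : RandersSpacetime.OneForm M)
    (hF : RandersSpacetime.IsFinslerSpacetime A F)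
    (hR : RandersSpacetime.IsRanders A F a b) :
    List.TFAE [
      RandersSpacetime.IsBerwald A F ∧ RandersSpacetime.SolvesFinslerVacuum A F,
      RandersSpacetime.SolvesEinsteinVacuum a ∧ RandersSpacetime.IsBerwald A F,
      RandersSpacetime.SolvesEinsteinVacuum a ∧ RandersSpacetime.IsParallel a b] :=
  mainTheorem4_general A F a b hF.isOpen hF.fiber_nonempty hR fun e he x hx y hy =>
    (hF.lorentzian e he x hx y hy).det_ne_zero
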